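/- All graphs are finite and simple. For a graph $G=(V,E)$ and a positive integer $k$, a $k$-weighting of $G$ is a map $\omega:E\to\{1,\dots,k\}$; the weighted degree of a vertex $v$ is $\sigma_\omega(v)=\sum_{u\in N(v)}\omega(uv)$. The irregularity strength $s(G)$ is the least $k$ for which there is a $k$-weighting $\omega$ of $G$ with $\sigma_\omega(u)\neq\sigma_\omega(v)$ for all distinct vertices $u,v$; if there is no such $k$, then $s(G)=+\infty$. Write $\delta(G)$ for the minimum degree of $G$. **Theorem.** Let $K\ge 3$ be an integer. 1. There is a constant $C$, depending only on $K$, such that $s(G)\le K$ for every graph $G$ of order $n\ge 2$ with $$\delta(G)\ \ge\ \left(\frac{1}{K-1}+\frac{C}{\left(\frac{n}{\ln n}\right)^{1/6}}\right)n .$$ 2. The threshold $\frac1{K-1}$ is asymptotically optimal: every $d$-regular graph $G$ of order $n=d(K-1)+2$ satisfies $s(G)>K$, and such graphs exist for arbitrarily large $d$. 3. Consequently, if $\delta_K(n)$ denotes the least integer $m\ge 0$ such that every graph of order $n$ with minimum degree at least $m$ has irregularity strength at most $K$, then $\delta_K(n)/n\to \frac{1}{K-1}$ as $n\to\infty$.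 Moreover, the supremum of all $\alpha\in(0,1)$ such that $s(G)\le K$ for every graph $G$ of sufficiently large order $n$ (that is, $n\ge n_0$ for some $n_0=n_0(K,\alpha)$) with $\delta(G)\ge(1-\alpha)n$ equals $1-\frac{1}{K-1}$. -/

import Mathlib

open Filter Topology

universe u

namespace SimpleGraph

/-- `ω` is a weighting of the edges of `G` with weights in `{1, …, k}`
(the values of `ω` off the edge set play no role). -/
def IsEdgeWeighting {V : Type*} (G : SimpleGraph V) (k : ℕ) (ω : Sym2 V → ℕ) : Prop :=
  ∀ e ∈ G.edgeSet, 1 ≤ ω e ∧ ω e ≤ k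

/-- The weighted degree of `v`: the sum of the weights of the edges at `v`. -/
def weightedDegree {V : Type*} [Fintype V] (G : SimpleGraph V) [DecidableRel G.Adj]
    (ω : Sym2 V → ℕ) (v : V) : ℕ :=
  ∑ u ∈ G.neighborFinset v, ω s(u, v)

/-- The irregularity strength of `G`: the least `k ≥ 1` for which some weighting of the edges with
weights in `{1, …, k}` gives pairwise distinct weighted degrees to the vertices. It is `⊤` if there
is no such `k`, in particular if `G` has an isolated edge or two isolated vertices. -/
noncomputable def irregularityStrength {V : Type*} [Fintype V] (G : SimpleGraph V)
    [DecidableRel G.Adj] : ℕ∞ :=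
  sInf {s : ℕ∞ | ∃ k : ℕ, 1 ≤ k ∧ s = k ∧
    ∃ ω : Sym2 V → ℕ, G.IsEdgeWeighting k ω ∧ Function.Injective (G.weightedDegree ω)}

/-- The least `m` such that every graph of order `n` with minimum degree at least `m` has
irregularity strength at most `K`. (Every `m ≥ n ≥ 1` qualifies, vacuously.) -/
noncomputable def irregularityThreshold (K n : ℕ) : ℕ :=
  sInf {m : ℕ | ∀ (G : SimpleGraph (Fin n)) [DecidableRel G.Adj],
    m ≤ G.minDegree → G.irregularityStrength ≤ K}

end SimpleGraph

/-! Upper bound. Give every vertex an independent random kind and a random position `i < n`. Between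
non-reserve vertices an edge gets weight `K` if the positions sum to at least `n`, and 1 otherwise.
The expected weighted degree of a vertex of degree `d` is then affine in its position, so its
possible values are spread evenly over a range of length about `d (K - 1)`. The surplus `ε` in the
minimum degree makes this range longer than `n`, so an interval of length `ℓ` is hit by fewer than
about `(1 - ε / 2) ℓ` vertices, up to a deviation `s` of order `√(n log n)` supplied by Hoeffding's
inequality.

These approximate degrees are then made distinct deterministically
(`exists_injective_weighting_of_kinds`). Underloaded intervals allow linear probing: each bulk
vertex moves up by at most `D` to a private value, and each paired vertex to a private block `{2t,
2t + 1}`. The moves raise edges to reserve vertices from 1 to 2. The few reserve vertices are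
treated last. They change edges to paired vertices from 2 to 1 or 3, one reserve vertex after
another, so that every paired vertex changes in total by 0 or 1 and stays in its block, while each
reserve vertex reaches a free value. The Boolean in the kinds separates the two uses: `reserve i` is
raised from `paired i` and toggled with `paired (!i)`. Weight 3 is where `K ≥ 3` enters.

The exponent `1/6` comes from the balance of sizes. Probing needs `D` of order `s / ε`. A vertex
needs at least `D` reserve neighbours, while the reserve may hold only about `ε ^ 2 n` vertices,
because the free values within reach of a reserve vertex are an `ε`-fraction of its roughly `ε n`
paired neighbours. Hence `s ≲ ε ^ 3 n`, that is, `ε` of order `(log n / n) ^ (1/6)`.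

Lower bound. In a `d`-regular graph all weighted degrees lie in `[d, dK]`, which is too short for `d
(K - 1) + 2` vertices. Circulant graphs provide examples of every order. -/

/-! ### Linear probing and the placement of single values and blocks -/

/-- Linear probing: the items of `S` are stored in distinct cells outside `F`, the cell of `v` being
at or after `σ v`, with all cells from `σ v` to the cell of `v` occupied in the end. -/
theorem exists_probing {ι : Type*} [DecidableEq ι] (S : Finset ι) (σ : ι → ℕ) (F : Finset ℕ) :
    ∃ t : ι → ℕ, Set.InjOn t S ∧ (∀ v ∈ S, σ v ≤ t v ∧ t v ∉ F) ∧
      ∀ v ∈ S, ∀ x, σ v ≤ x → x ≤ t v → x ∈ F ∨ ∃ u ∈ S, t u = x := by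
  induction S using Finset.induction_on with
  | empty => exact ⟨fun _ => 0, by simp⟩
  | insert v S hv ih =>
    obtain ⟨t, hinj, ht, hfull⟩ := ih
    -- The new item takes the first free cell from `σ v` on; the earlier items never move.
    have hex : ∃ x, σ v ≤ x ∧ x ∉ F ∪ S.image t := by
      obtain ⟨x, hx⟩ := Infinite.exists_notMem_finset (F ∪ S.image t ∪ Finset.range (σ v))
      rw [Finset.mem_union, not_or] at hx
      exact ⟨x, by simpa using hx.2, hx.1⟩
    classical
    set y := Nat.find hex with hy
    obtain ⟨hy1, hy2⟩ := Nat.find_spec hex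
    have hmin : ∀ x, σ v ≤ x → x < y → x ∈ F ∪ S.image t := by
      intro x hx hxy
      by_contra hcon
      exact Nat.find_min hex hxy ⟨hx, hcon⟩
    rw [← hy] at hy1 hy2
    have hne : ∀ u ∈ S, u ≠ v := fun u hu h => hv (h ▸ hu)
    have hup : ∀ u ∈ S, Function.update t v y u = t u := fun u hu => by simp [hne u hu]
    have hnew : ∀ u ∈ S, t u ≠ y := by
      intro u hu h
      apply hy2
      rw [← h]
      exact Finset.mem_union_right _ (Finset.mem_image_of_mem _ hu)
    refine ⟨Function.update t v y, ?_, ?_, ?_⟩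
    · intro a ha b hb hab
      simp only [Finset.coe_insert, Set.mem_insert_iff, Finset.mem_coe] at ha hb
      rcases ha with rfl | ha <;> rcases hb with rfl | hb
      · rfl
      · rw [hup b hb, Function.update_self] at hab
        exact absurd hab.symm (hnew b hb)
      · rw [hup a ha, Function.update_self] at hab
        exact absurd hab (hnew a ha)
      · rw [hup a ha, hup b hb] at hab
        exact hinj ha hb hab
    · intro u hu
      rcases Finset.mem_insert.1 hu with rfl | hu
      · rw [Function.update_self]
        exact ⟨hy1, fun h => hy2 (Finset.mem_union_left _ h)⟩
      · rw [hup u hu]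
        exact ht u hu
    · have key : ∀ x, x ∈ F ∪ S.image t →
          x ∈ F ∨ ∃ u ∈ insert v S, Function.update t v y u = x := by
        intro x hx
        rcases Finset.mem_union.1 hx with hx | hx
        · exact Or.inl hx
        · obtain ⟨u, hu, rfl⟩ := Finset.mem_image.1 hx
          exact Or.inr ⟨u, Finset.mem_insert_of_mem hu, hup u hu⟩
      intro u hu x hx1 hx2
      rcases Finset.mem_insert.1 hu with rfl | hu
      · rw [Function.update_self] at hx2
        rcases hx2.lt_or_eq with h | h
        · exact key x (hmin x hx1 h)
        · exact Or.inr ⟨u, Finset.mem_insert_self _ _, by rw [Function.update_self, h]⟩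
      · rw [hup u hu] at hx2
        apply key
        rcases hfull u hu x hx1 hx2 with h | ⟨z, hz, rfl⟩
        · exact Finset.mem_union_left _ h
        · exact Finset.mem_union_right _ (Finset.mem_image_of_mem _ hz)

/-- The run of occupied cells that ends in the cell of `w`. -/
theorem exists_run_of_probing {ι : Type*} {S : Finset ι} {σ t : ι → ℕ} {F : Finset ℕ}
    (hfull : ∀ v ∈ S, ∀ x, σ v ≤ x → x ≤ t v → x ∈ F ∨ ∃ u ∈ S, t u = x) {w : ι} (hw : w ∈ S) :
    ∃ a ≤ σ w, (∀ x, a ≤ x → x ≤ t w → x ∈ F ∨ ∃ u ∈ S, t u = x) ∧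
      (∀ u ∈ S, a ≤ t u → a ≤ σ u) ∧ (a = 0 ∨ a - 1 ∉ F) := by
  classical
  -- Take the least start `a` of an occupied run ending at `t w`. The cell `a - 1` is then free, and
  -- an item probed from below `a` to a cell beyond it would have left `a - 1` occupied.
  have hex : ∃ a, ∀ x, a ≤ x → x ≤ t w → x ∈ F ∨ ∃ u ∈ S, t u = x := ⟨σ w, hfull w hw⟩
  obtain ⟨a, ha⟩ : ∃ a, a = Nat.find hex := ⟨_, rfl⟩
  have hspec := Nat.find_spec hex
  have hle : Nat.find hex ≤ σ w := Nat.find_min' hex (hfull w hw)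
  have hpred : 0 < a → ¬(a - 1 ∈ F ∨ ∃ u ∈ S, t u = a - 1) := by
    intro hpos hcon
    refine Nat.find_min hex (m := a - 1) (by omega) fun x hx1 hx2 => ?_
    rcases hx1.eq_or_lt with h | h
    · exact h ▸ hcon
    · exact hspec x (by omega) hx2
  rw [← ha] at hspec hle
  refine ⟨a, hle, hspec, ?_, ?_⟩
  · intro u hu hau
    by_contra hlt
    exact hpred (by omega) (hfull u hu (a - 1) (by omega) (by omega))
  · by_contra! hcon
    exact hpred (by omega) (Or.inl hcon.2)

/-- If every long interval is underloaded, the items of `R` can be moved up by at most `D` into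
distinct cells, and those of `A` into distinct pairs of consecutive cells, without overlaps. -/
theorem exists_block_assignment {V : Type*} [DecidableEq V] (R A : Finset V) (σ : V → ℕ) (D : ℕ)
    (hload : ∀ a b : ℕ, a + D ≤ b → (R.filter fun v => a - 1 ≤ σ v ∧ σ v ≤ b).card +
      2 * (A.filter fun v => a - 1 ≤ σ v ∧ σ v ≤ b).card + a ≤ b) :
    ∃ tR tA : V → ℕ, Set.InjOn tR R ∧ Set.InjOn tA A ∧
      (∀ v ∈ R, σ v ≤ tR v ∧ tR v ≤ σ v + D) ∧
      (∀ v ∈ A, σ v ≤ 2 * tA v ∧ 2 * tA v ≤ σ v + D) ∧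
      ∀ v ∈ R, ∀ a ∈ A, tR v ≠ 2 * tA a ∧ tR v ≠ 2 * tA a + 1 := by
  -- The blocks are placed first, as single items at half scale. Rounding `σ v` up to an even number
  -- is why loads are counted from `a - 1`.
  obtain ⟨tA, hAinj, hA, hAfull⟩ := exists_probing A (fun v => (σ v + 1) / 2) ∅
  set F : Finset ℕ := A.image (fun v => 2 * tA v) ∪ A.image (fun v => 2 * tA v + 1) with hF
  obtain ⟨tR, hRinj, hR, hRfull⟩ := exists_probing R σ F
  have hmemF : ∀ x, x ∈ F ↔ ∃ u ∈ A, tA u = x / 2 := by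
    intro x
    simp only [hF, Finset.mem_union, Finset.mem_image]
    constructor
    · rintro (⟨u, hu, rfl⟩ | ⟨u, hu, rfl⟩)
      · exact ⟨u, hu, by omega⟩
      · exact ⟨u, hu, by omega⟩
    · rintro ⟨u, hu, h⟩
      rcases Nat.even_or_odd' x with ⟨y, rfl | rfl⟩
      · exact Or.inl ⟨u, hu, by omega⟩
      · exact Or.inr ⟨u, hu, by omega⟩
  refine ⟨tR, tA, hRinj, hAinj, fun v hv => ⟨(hR v hv).1, ?_⟩, fun v hv => ?_, ?_⟩
  · by_contra! hlt
    obtain ⟨a, ha, hrun, hstart, hF0⟩ := exists_run_of_probing hRfull hv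
    -- Otherwise the probing of `u` passed the block containing `a - 1`, so that `a - 1 ∈ F`.
    have hstartA : ∀ u ∈ A, a ≤ 2 * tA u + 1 → a - 1 ≤ σ u := by
      intro u hu hau
      by_contra! hcon
      rcases hF0 with h0 | h0
      · omega
      · apply h0
        rw [hmemF]
        have hau' : (a - 1) / 2 ≤ tA u := by omega
        have := hAfull u hu ((a - 1) / 2) (by omega) hau'
        simpa using this
    -- Every cell of the run is paid for by an item counted in its load, so the load is at least `tR
    -- v - a + 1`; `hload` allows only `tR v - a`.
    have hsub : Finset.Icc a (tR v) ⊆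
        ((R.filter fun u => a - 1 ≤ σ u ∧ σ u ≤ tR v).image tR ∪
          ((A.filter fun u => a - 1 ≤ σ u ∧ σ u ≤ tR v).image (fun u => 2 * tA u) ∪
          (A.filter fun u => a - 1 ≤ σ u ∧ σ u ≤ tR v).image (fun u => 2 * tA u + 1))) := by
      intro x hx
      rw [Finset.mem_Icc] at hx
      simp only [Finset.mem_union, Finset.mem_image, Finset.mem_filter]
      rcases hrun x hx.1 hx.2 with h | ⟨u, hu, rfl⟩
      · obtain ⟨u, hu, h⟩ := (hmemF x).1 h
        have h1 := hstartA u hu (by omega)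
        have h2 := (hA u hu).1
        right
        rcases Nat.even_or_odd' x with ⟨y, rfl | rfl⟩
        · exact Or.inl ⟨u, ⟨hu, h1, by omega⟩, by omega⟩
        · exact Or.inr ⟨u, ⟨hu, h1, by omega⟩, by omega⟩
      · have h1 := hstart u hu hx.1
        exact Or.inl ⟨u, ⟨hu, by omega, by have := (hR u hu).1; omega⟩, rfl⟩
    have hcard := Finset.card_le_card hsub
    rw [Nat.card_Icc] at hcard
    have h1 := hload a (tR v) (by omega)
    have h2 := (hcard.trans (Finset.card_union_le _ _)).trans
      (add_le_add Finset.card_image_le ((Finset.card_union_le _ _).trans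
        (add_le_add Finset.card_image_le Finset.card_image_le)))
    omega
  · have hv1 := (hA v hv).1
    refine ⟨by omega, ?_⟩
    by_contra! hlt
    obtain ⟨a, ha, hrun, hstart, -⟩ := exists_run_of_probing hAfull hv
    have hsub : Finset.Icc a (tA v) ⊆
        (A.filter fun u => 2 * a - 1 ≤ σ u ∧ σ u ≤ 2 * tA v).image tA := by
      intro x hx
      rw [Finset.mem_Icc] at hx
      rcases hrun x hx.1 hx.2 with h | ⟨u, hu, rfl⟩
      · simp at h
      · have h1 := hstart u hu hx.1
        have h2 := (hA u hu).1
        exact Finset.mem_image.2 ⟨u, Finset.mem_filter.2 ⟨hu, by omega, by omega⟩, rfl⟩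
    have hcard := (Finset.card_le_card hsub).trans Finset.card_image_le
    rw [Nat.card_Icc] at hcard
    have h1 := hload (2 * a) (2 * tA v) (by omega)
    omega
  · intro v hv a ha
    have h := (hR v hv).2
    rw [hmemF] at h
    constructor <;> intro hcon <;> exact h ⟨a, ha, by omega⟩

/-! ### Toggling along the edges at the reserve -/

/-- Vertices `b ∈ B` one after the other change the values of their neighbours `a ∈ N b` by `±1`,
keeping the total change at each `a` in `{0, 1}`, so that the total changes at the `b ∈ B` lead to
distinct values outside `F`. -/
theorem exists_toggling {V : Type*} [DecidableEq V] (B : Finset V) (N : V → Finset V) (τ : V → ℕ)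
    (F : Finset ℕ) (hτ : ∀ b ∈ B, (N b).card ≤ τ b)
    (hF : ∀ b ∈ B, ∀ c, (F ∩ Finset.Icc c (c + (N b).card)).card + B.card ≤ (N b).card) :
    ∃ z : V → V → ℤ, (∀ b a, z b a = -1 ∨ z b a = 0 ∨ z b a = 1) ∧
      (∀ b a, z b a ≠ 0 → b ∈ B ∧ a ∈ N b) ∧
      (∀ a, ∑ b ∈ B, z b a = 0 ∨ ∑ b ∈ B, z b a = 1) ∧
      ∃ y : V → ℕ, (∀ b ∈ B, (y b : ℤ) = τ b + ∑ a ∈ N b, z b a) ∧ Set.InjOn y B ∧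
        ∀ b ∈ B, y b ∉ F := by
  suffices h : ∀ S ⊆ B, ∃ z : V → V → ℤ, (∀ b a, z b a = -1 ∨ z b a = 0 ∨ z b a = 1) ∧
      (∀ b a, z b a ≠ 0 → b ∈ S ∧ a ∈ N b) ∧
      (∀ a, ∑ b ∈ S, z b a = 0 ∨ ∑ b ∈ S, z b a = 1) ∧
      ∃ y : V → ℕ, (∀ b ∈ S, (y b : ℤ) = τ b + ∑ a ∈ N b, z b a) ∧ Set.InjOn y S ∧
        ∀ b ∈ S, y b ∉ F from h B subset_rfl
  intro S
  induction S using Finset.induction_on with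
  | empty => exact fun _ => ⟨fun _ _ => 0, by simp⟩
  | insert b S hb ih =>
    intro hSB
    obtain ⟨hbB, hSB'⟩ := Finset.insert_subset_iff.1 hSB
    obtain ⟨z, hz1, hz2, hz3, y, hy, hinj, hyF⟩ := ih hSB'
    -- Neighbours in `H` can only go down, the others only up. So `b` can be shifted by every
    -- integer from `-H.card` to `L.card`: these are `(N b).card + 1` consecutive values, one more
    -- than `F` and the earlier choices can block. By `hτ` the subtraction `τ b - H.card` does not
    -- truncate.
    set H := (N b).filter fun a => ∑ b ∈ S, z b a = 1 with hH
    set L := (N b).filter fun a => ¬ ∑ b ∈ S, z b a = 1 with hL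
    have hHL : H.card + L.card = (N b).card := Finset.card_filter_add_card_filter_not _
    have hτb := hτ b hbB
    obtain ⟨x, hx1, hx2, hx3⟩ : ∃ x ∈ Finset.Icc (τ b - H.card) (τ b - H.card + (N b).card),
        x ∉ F ∧ x ∉ S.image y := by
      by_contra! hcon
      have hsub : Finset.Icc (τ b - H.card) (τ b - H.card + (N b).card) ⊆
          (F ∩ Finset.Icc (τ b - H.card) (τ b - H.card + (N b).card)) ∪ S.image y := by
        intro x hx
        by_cases hxF : x ∈ F
        · exact Finset.mem_union_left _ (Finset.mem_inter.2 ⟨hxF, hx⟩)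
        · exact Finset.mem_union_right _ (hcon x hx hxF)
      have h1 := (Finset.card_le_card hsub).trans (Finset.card_union_le _ _)
      have h2 := hF b hbB (τ b - H.card)
      have h3 : (S.image y).card ≤ B.card := Finset.card_image_le.trans (Finset.card_le_card hSB')
      rw [Nat.card_Icc] at h1
      omega
    rw [Finset.mem_Icc] at hx1
    obtain ⟨e, he1, he2⟩ : ∃ e : V → ℤ, (∀ a, e a = 0 ∨ a ∈ H ∧ e a = -1 ∨ a ∈ L ∧ e a = 1) ∧
        (x : ℤ) = τ b + ∑ a ∈ N b, e a := by
      rcases le_total (τ b) x with hle | hle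
      · obtain ⟨T, hT, hTc⟩ := Finset.exists_subset_card_eq (s := L) (n := x - τ b) (by omega)
        refine ⟨fun a => if a ∈ T then 1 else 0, fun a => ?_, ?_⟩
        · by_cases h : a ∈ T
          · simp [h, hT h]
          · simp [h]
        · rw [Finset.sum_ite_mem, Finset.inter_eq_right.2 (hT.trans (Finset.filter_subset _ _))]
          simp [hTc]
          omega
      · obtain ⟨T, hT, hTc⟩ := Finset.exists_subset_card_eq (s := H) (n := τ b - x) (by omega)
        refine ⟨fun a => if a ∈ T then -1 else 0, fun a => ?_, ?_⟩
        · by_cases h : a ∈ T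
          · simp [h, hT h]
          · simp [h]
        · rw [Finset.sum_ite_mem, Finset.inter_eq_right.2 (hT.trans (Finset.filter_subset _ _))]
          simp [hTc]
          omega
    have hne : ∀ u ∈ S, u ≠ b := fun u hu h => hb (h ▸ hu)
    refine ⟨Function.update z b e, ?_, ?_, ?_, Function.update y b x, ?_, ?_, ?_⟩
    · intro u a
      by_cases hu : u = b
      · subst hu
        rw [Function.update_self]
        rcases he1 a with h | h | h <;> simp [h]
      · rw [Function.update_of_ne hu]
        exact hz1 u a
    · intro u a
      by_cases hu : u = b
      · subst hu
        rw [Function.update_self]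
        intro hea
        refine ⟨Finset.mem_insert_self _ _, ?_⟩
        rcases he1 a with h | h | h
        · exact absurd h hea
        · exact (Finset.mem_filter.1 h.1).1
        · exact (Finset.mem_filter.1 h.1).1
      · rw [Function.update_of_ne hu]
        exact fun h => ⟨Finset.mem_insert_of_mem (hz2 u a h).1, (hz2 u a h).2⟩
    · intro a
      rw [Finset.sum_insert hb, Function.update_self, Finset.sum_congr rfl fun u hu => by
        rw [Function.update_of_ne (hne u hu)]]
      rcases he1 a with h | h | h
      · rw [h, zero_add]
        exact hz3 a
      · rw [h.2, (Finset.mem_filter.1 h.1).2]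
        simp
      · rw [h.2, (hz3 a).resolve_right (Finset.mem_filter.1 h.1).2]
        simp
    · intro u hu
      rcases Finset.mem_insert.1 hu with rfl | hu
      · simp [he2]
      · rw [Function.update_of_ne (hne u hu), Function.update_of_ne (hne u hu)]
        exact hy u hu
    · have hnew : ∀ u ∈ S, y u ≠ x := fun u hu h => hx3 (h ▸ Finset.mem_image_of_mem _ hu)
      intro u hu v hv huv
      simp only [Finset.coe_insert, Set.mem_insert_iff, Finset.mem_coe] at hu hv
      rcases hu with rfl | hu <;> rcases hv with rfl | hv
      · rfl
      · rw [Function.update_self, Function.update_of_ne (hne v hv)] at huv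
        exact absurd huv.symm (hnew v hv)
      · rw [Function.update_self, Function.update_of_ne (hne u hu)] at huv
        exact absurd huv (hnew u hu)
      · rw [Function.update_of_ne (hne u hu), Function.update_of_ne (hne v hv)] at huv
        exact hinj hu hv huv
    · intro u hu
      rcases Finset.mem_insert.1 hu with rfl | hu
      · simpa using hx2
      · rw [Function.update_of_ne (hne u hu)]
        exact hyF u hu

/-! ### Hoeffding's inequality for finite product distributions -/

/-- The exponential moment bound for a centred random variable with values in `[-1, 1]`. -/
theorem sum_mul_exp_le_of_abs_le_one {Λ : Type*} [Fintype Λ] {p g : Λ → ℝ} (hp : ∀ l, 0 ≤ p l)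
    (hp1 : ∑ l, p l = 1) (hg : ∀ l, |g l| ≤ 1) (hg0 : ∑ l, p l * g l = 0) (t : ℝ) :
    ∑ l, p l * Real.exp (t * g l) ≤ Real.exp (t ^ 2 / 2) := by
  -- On `[-1, 1]` the convex function `x ↦ exp (t * x)` lies below its chord.
  have hpt : ∀ l, Real.exp (t * g l) ≤ Real.cosh t + g l * Real.sinh t := by
    intro l
    obtain ⟨h1, h2⟩ := abs_le.1 (hg l)
    have := convexOn_exp.2 (Set.mem_univ t) (Set.mem_univ (-t))
      (show 0 ≤ (1 + g l) / 2 by linarith) (show 0 ≤ (1 - g l) / 2 by linarith) (by ring)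
    simp only [smul_eq_mul] at this
    rw [Real.cosh_eq, Real.sinh_eq]
    calc Real.exp (t * g l) = Real.exp ((1 + g l) / 2 * t + (1 - g l) / 2 * -t) := by ring_nf
      _ ≤ _ := this
      _ = _ := by ring
  calc ∑ l, p l * Real.exp (t * g l) ≤ ∑ l, p l * (Real.cosh t + g l * Real.sinh t) :=
        Finset.sum_le_sum fun l _ => mul_le_mul_of_nonneg_left (hpt l) (hp l)
    _ = Real.cosh t * ∑ l, p l + Real.sinh t * ∑ l, p l * g l := by
        rw [Finset.mul_sum, Finset.mul_sum, ← Finset.sum_add_distrib]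
        exact Finset.sum_congr rfl fun l _ => by ring
    _ = Real.cosh t := by rw [hp1, hg0]; ring
    _ ≤ _ := Real.cosh_le_exp_half_sq t

/-- Hoeffding's inequality and the union bound: independent random labels make all sums in a small
family of sums of bounded functions of the labels deviate little from their means. -/
theorem exists_forall_abs_sum_sub_le {V Λ I : Type*} [Fintype V] [DecidableEq V] [Fintype Λ]
    [Fintype I] {p : Λ → ℝ} (hp : ∀ l, 0 ≤ p l) (hp1 : ∑ l, p l = 1) {f : I → V → Λ → ℝ} {M s : ℝ}
    (hM : 0 < M) (hV : 0 < Fintype.card V) (hs : 0 < s) (hf : ∀ i v l, 0 ≤ f i v l ∧ f i v l ≤ M)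
    (hcard : 2 * (Fintype.card I : ℝ) < Real.exp (s ^ 2 / (2 * M ^ 2 * Fintype.card V))) :
    ∃ x : V → Λ, ∀ i, |∑ v, f i v (x v) - ∑ v, ∑ l, p l * f i v l| ≤ s := by
  by_contra! hcon
  set n : ℝ := (Fintype.card V : ℝ) with hn
  have hn0 : 0 < n := by rw [hn]; exact_mod_cast hV
  set m : I → V → ℝ := fun i v => ∑ l, p l * f i v l with hm
  have hm0 : ∀ i v, 0 ≤ m i v := fun i v =>
    Finset.sum_nonneg fun l _ => mul_nonneg (hp l) (hf i v l).1
  have hmM : ∀ i v, m i v ≤ M := fun i v => by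
    calc m i v ≤ ∑ l, p l * M :=
          Finset.sum_le_sum fun l _ => mul_le_mul_of_nonneg_left (hf i v l).2 (hp l)
      _ = M := by rw [← Finset.sum_mul, hp1, one_mul]
  set g : I → V → Λ → ℝ := fun i v l => (f i v l - m i v) / M with hg
  have hg1 : ∀ i v l, |g i v l| ≤ 1 := by
    intro i v l
    rw [hg, abs_le]
    constructor
    · rw [le_div_iff₀ hM]
      linarith [(hf i v l).1, hmM i v]
    · rw [div_le_iff₀ hM]
      linarith [(hf i v l).2, hm0 i v]
  have hg0 : ∀ i v, ∑ l, p l * g i v l = 0 := by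
    intro i v
    have : ∀ l, p l * g i v l = (p l * f i v l - p l * m i v) / M := fun l => by
      simp only [hg]; ring
    rw [Finset.sum_congr rfl fun l _ => this l, ← Finset.sum_div, Finset.sum_sub_distrib,
      ← Finset.sum_mul, hp1, one_mul, sub_self, zero_div]
  have hmgf : ∀ (t : ℝ) i, ∑ x : V → Λ, (∏ v, p (x v)) * Real.exp (t * ∑ v, g i v (x v)) ≤
      Real.exp (n * (t ^ 2 / 2)) := by
    intro t i
    have h1 : ∀ x : V → Λ, (∏ v, p (x v)) * Real.exp (t * ∑ v, g i v (x v)) =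
        ∏ v, (p (x v) * Real.exp (t * g i v (x v))) := by
      intro x
      rw [Finset.prod_mul_distrib, Finset.mul_sum, Real.exp_sum]
    rw [Finset.sum_congr rfl fun x _ => h1 x, ← Fintype.piFinset_univ,
      ← Finset.prod_univ_sum (fun _ => Finset.univ) fun v l => p l * Real.exp (t * g i v l)]
    calc ∏ v, ∑ l, p l * Real.exp (t * g i v l) ≤ ∏ _v : V, Real.exp (t ^ 2 / 2) :=
          Finset.prod_le_prod
            (fun v _ => Finset.sum_nonneg fun l _ => mul_nonneg (hp l) (Real.exp_pos _).le)
            fun v _ => sum_mul_exp_le_of_abs_le_one hp hp1 (hg1 i v) (hg0 i v) t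
      _ = _ := by rw [Finset.prod_const, Finset.card_univ, ← Real.exp_nat_mul]
  have htotal : ∑ x : V → Λ, ∏ v, p (x v) = 1 := by
    rw [← Fintype.piFinset_univ, ← Finset.prod_univ_sum (fun _ => Finset.univ) fun (_ : V) l => p l]
    simp [hp1]
  -- This `t` minimises `n * t ^ 2 / 2 - t * s / M`, with minimum `-s ^ 2 / (2 * M ^ 2 * n)`.
  set t : ℝ := s / (M * n) with ht
  have ht0 : 0 < t := by positivity
  have hlow : ∀ x : V → Λ, Real.exp (t * (s / M)) ≤
      ∑ i, (Real.exp (t * ∑ v, g i v (x v)) + Real.exp (-t * ∑ v, g i v (x v))) := by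
    intro x
    obtain ⟨i, hi⟩ := hcon x
    have hsum : ∑ v, g i v (x v) = (∑ v, f i v (x v) - ∑ v, m i v) / M := by
      rw [← Finset.sum_sub_distrib, Finset.sum_div]
    have hi' : s / M ≤ |∑ v, g i v (x v)| := by
      rw [hsum, abs_div, abs_of_pos hM]
      gcongr
    refine le_trans ?_ (Finset.single_le_sum (f := fun i => Real.exp (t * ∑ v, g i v (x v)) +
      Real.exp (-t * ∑ v, g i v (x v))) (fun j _ => by positivity) (Finset.mem_univ i))
    rcases le_abs.1 hi' with h | h
    · have := Real.exp_le_exp.2 (mul_le_mul_of_nonneg_left h ht0.le)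
      linarith [Real.exp_pos (-t * ∑ v, g i v (x v))]
    · have := Real.exp_le_exp.2 (mul_le_mul_of_nonneg_left h ht0.le)
      rw [mul_neg, ← neg_mul] at this
      linarith [Real.exp_pos (t * ∑ v, g i v (x v))]
  have hfinal : Real.exp (t * (s / M)) ≤ 2 * Fintype.card I * Real.exp (n * (t ^ 2 / 2)) := by
    calc Real.exp (t * (s / M)) = ∑ x : V → Λ, (∏ v, p (x v)) * Real.exp (t * (s / M)) := by
          rw [← Finset.sum_mul, htotal, one_mul]
      _ ≤ ∑ x : V → Λ, (∏ v, p (x v)) *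
          ∑ i, (Real.exp (t * ∑ v, g i v (x v)) + Real.exp (-t * ∑ v, g i v (x v))) :=
          Finset.sum_le_sum fun x _ => mul_le_mul_of_nonneg_left (hlow x)
            (Finset.prod_nonneg fun v _ => hp _)
      _ = ∑ i, (∑ x : V → Λ, (∏ v, p (x v)) * Real.exp (t * ∑ v, g i v (x v)) +
          ∑ x : V → Λ, (∏ v, p (x v)) * Real.exp (-t * ∑ v, g i v (x v))) := by
          simp_rw [Finset.mul_sum, mul_add]
          rw [Finset.sum_comm]
          simp_rw [Finset.sum_add_distrib]
      _ ≤ ∑ _i : I, (Real.exp (n * (t ^ 2 / 2)) + Real.exp (n * ((-t) ^ 2 / 2))) :=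
          Finset.sum_le_sum fun i _ => add_le_add (hmgf t i) (hmgf (-t) i)
      _ = _ := by
          rw [Finset.sum_const, Finset.card_univ, nsmul_eq_mul, neg_sq]
          ring
  have he : t * (s / M) = s ^ 2 / (2 * M ^ 2 * n) + n * (t ^ 2 / 2) := by
    rw [ht]; field_simp; ring
  rw [he, Real.exp_add] at hfinal
  exact absurd (le_of_mul_le_mul_right hfinal (Real.exp_pos _)) (not_le.2 hcard)

/-! ### Deterministic correction to distinct weighted degrees -/

/-- The roles of the vertices: the edges between `reserve` vertices and the others are used for
adjusting the weighted degrees, those of the `paired` vertices only up to an additive error `1`. -/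
inductive VertexKind
  | bulk
  | paired (i : Bool)
  | reserve (i : Bool)
  deriving DecidableEq, Fintype

namespace SimpleGraph

/-- A symmetric weight function is corrected along the edges at the `reserve` vertices to a
weighting with distinct weighted degrees. -/
theorem exists_injective_weighting_of_kinds {V : Type*} [Fintype V] [DecidableEq V]
    (G : SimpleGraph V) [DecidableRel G.Adj] {K : ℕ} (hK : 3 ≤ K) (κ : V → VertexKind)
    (w : V → V → ℕ) (hw : ∀ u v, w u v = w v u) (hw1 : ∀ u v, 1 ≤ w u v ∧ w u v ≤ K)
    (hwR : ∀ u v i, κ u = .bulk → κ v = .reserve i → w u v = 1)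
    (hwA : ∀ u v i, κ u = .paired i → κ v = .reserve i → w u v = 1)
    (hwA' : ∀ u v i, κ u = .paired (!i) → κ v = .reserve i → w u v = 2)
    {σ : V → ℕ} (hσ : ∀ v, σ v = ∑ u ∈ G.neighborFinset v, w u v) {load : ℕ → ℕ → ℕ}
    (hload : ∀ a b, load a b =
      ((Finset.univ.filter fun v => κ v = .bulk).filter fun v => a ≤ σ v ∧ σ v ≤ b).card +
      2 * ((Finset.univ.filter fun v => ∃ i, κ v = .paired i).filter
        fun v => a ≤ σ v ∧ σ v ≤ b).card) {D : ℕ}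
    (hDR : ∀ v, κ v = .bulk →
      D ≤ ((G.neighborFinset v).filter fun u => κ u = .reserve false).card)
    (hDA : ∀ v i, κ v = .paired i →
      D ≤ ((G.neighborFinset v).filter fun u => κ u = .reserve i).card)
    (hload1 : ∀ a b, a + D ≤ b → load (a - 1) b + a ≤ b)
    (hload2 : ∀ v i, κ v = .reserve i → ∀ c,
      load (c - 1 - D) (c + ((G.neighborFinset v).filter fun u => κ u = .paired (!i)).card) +
        (Finset.univ.filter fun v => ∃ i, κ v = .reserve i).card ≤
      ((G.neighborFinset v).filter fun u => κ u = .paired (!i)).card) :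
    ∃ ω : Sym2 V → ℕ, G.IsEdgeWeighting K ω ∧ Function.Injective (G.weightedDegree ω) := by
  set R := Finset.univ.filter fun v => κ v = .bulk with hR
  set A := Finset.univ.filter fun v => ∃ i, κ v = .paired i with hA
  set B := Finset.univ.filter fun v => ∃ i, κ v = .reserve i with hB
  obtain ⟨tR, tA, hRinj, hAinj, htR, htA, hdisj⟩ := exists_block_assignment R A σ D
    fun a b hab => by simpa only [hload] using hload1 a b hab
  -- the raised edges
  have hS : ∀ v, ∃ S ⊆ G.neighborFinset v,
      (∀ u ∈ S, (κ v = .bulk ∧ κ u = .reserve false) ∨ ∃ i, κ v = .paired i ∧ κ u = .reserve i) ∧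
      (κ v = .bulk → σ v + S.card = tR v) ∧ ∀ i, κ v = .paired i → σ v + S.card = 2 * tA v := by
    intro v
    rcases hv : κ v with _ | i | i
    · have h1 := htR v (by simp [hR, hv])
      obtain ⟨S, hS1, hS2⟩ := Finset.exists_subset_card_eq
        (s := (G.neighborFinset v).filter fun u => κ u = .reserve false) (n := tR v - σ v)
        (by have := hDR v hv; omega)
      exact ⟨S, hS1.trans (Finset.filter_subset _ _),
        fun u hu => Or.inl ⟨rfl, (Finset.mem_filter.1 (hS1 hu)).2⟩, fun _ => by omega, by simp⟩
    · have h1 := htA v (by simp [hA, hv])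
      obtain ⟨S, hS1, hS2⟩ := Finset.exists_subset_card_eq
        (s := (G.neighborFinset v).filter fun u => κ u = .reserve i) (n := 2 * tA v - σ v)
        (by have := hDA v i hv; omega)
      exact ⟨S, hS1.trans (Finset.filter_subset _ _),
        fun u hu => Or.inr ⟨i, rfl, (Finset.mem_filter.1 (hS1 hu)).2⟩, by simp,
        fun _ _ => by omega⟩
    · exact ⟨∅, by simp⟩
  choose S hSN hSκ hSR hSA using hS
  set r : V → V → ℕ := fun v u => if u ∈ S v then 1 else 0 with hr
  have hr' : ∀ v u, r v u = 0 ∨ (r v u = 1 ∧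
      ((κ v = .bulk ∧ κ u = .reserve false) ∨ ∃ i, κ v = .paired i ∧ κ u = .reserve i)) := by
    intro v u
    by_cases h : u ∈ S v
    · exact Or.inr ⟨by simp [hr, h], hSκ v u h⟩
    · exact Or.inl (by simp [hr, h])
  -- the toggled edges
  set N : V → Finset V := fun v => (G.neighborFinset v).filter fun u =>
    ∃ i, κ v = .reserve i ∧ κ u = .paired (!i) with hN
  have hNeq : ∀ v i, κ v = .reserve i →
      N v = (G.neighborFinset v).filter fun u => κ u = .paired (!i) := by
    intro v i hv
    simp only [hN, hv]
    apply Finset.filter_congr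
    intro u _
    constructor
    · rintro ⟨j, hj, hu⟩
      cases hj
      exact hu
    · exact fun hu => ⟨i, rfl, hu⟩
  -- The weighted degree of a reserve vertex once all edges have been raised, before toggling.
  set τ : V → ℕ := fun v => σ v + ∑ u ∈ G.neighborFinset v, r u v with hτ
  set F : Finset ℕ := R.image tR ∪ (A.image (fun v => 2 * tA v) ∪ A.image (fun v => 2 * tA v + 1))
    with hF
  obtain ⟨z, hz1, hz2, hz3, y, hy, hyinj, hyF⟩ := exists_toggling B N τ F (by
    intro v _
    calc (N v).card ≤ (G.neighborFinset v).card := Finset.card_le_card (Finset.filter_subset _ _)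
      _ = ∑ u ∈ G.neighborFinset v, 1 := by simp
      _ ≤ ∑ u ∈ G.neighborFinset v, w u v := Finset.sum_le_sum fun u _ => (hw1 u v).1
      _ ≤ τ v := by rw [hτ, ← hσ]; exact Nat.le_add_right _ _) (by
    intro v hv c
    obtain ⟨i, hi⟩ := (Finset.mem_filter.1 hv).2
    have h := hload2 v i hi c
    rw [← hNeq v i hi] at h
    refine le_trans (Nat.add_le_add_right ?_ _) h
    set b := c + (N v).card with hb
    -- Values moved up by at most `D`, plus 1 for the upper cell of a block; hence the left end `c -
    -- 1 - D`.
    have hsub : F ∩ Finset.Icc c b ⊆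
        ((R.filter fun u => c - 1 - D ≤ σ u ∧ σ u ≤ b).image tR ∪
          ((A.filter fun u => c - 1 - D ≤ σ u ∧ σ u ≤ b).image (fun u => 2 * tA u) ∪
          (A.filter fun u => c - 1 - D ≤ σ u ∧ σ u ≤ b).image (fun u => 2 * tA u + 1))) := by
      intro x hx
      rw [Finset.mem_inter, Finset.mem_Icc] at hx
      obtain ⟨hxF, hx1, hx2⟩ := hx
      simp only [hF, Finset.mem_union, Finset.mem_image] at hxF
      simp only [Finset.mem_union, Finset.mem_image, Finset.mem_filter]
      rcases hxF with ⟨u, hu, rfl⟩ | ⟨u, hu, rfl⟩ | ⟨u, hu, rfl⟩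
      · have := htR u hu
        exact Or.inl ⟨u, ⟨hu, by omega, by omega⟩, rfl⟩
      · have := htA u hu
        exact Or.inr (Or.inl ⟨u, ⟨hu, by omega, by omega⟩, rfl⟩)
      · have := htA u hu
        exact Or.inr (Or.inr ⟨u, ⟨hu, by omega, by omega⟩, rfl⟩)
    have h1 := (((Finset.card_le_card hsub).trans (Finset.card_union_le _ _)).trans
      (add_le_add Finset.card_image_le ((Finset.card_union_le _ _).trans
        (add_le_add Finset.card_image_le Finset.card_image_le))))
    rw [hload]
    omega)
  have hz' : ∀ b a, z b a = 0 ∨ (∃ i, κ b = .reserve i ∧ κ a = .paired (!i)) ∧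
      (z b a = 1 ∨ z b a = -1) := by
    intro b a
    by_cases h : z b a = 0
    · exact Or.inl h
    · have h1 := (hz2 b a h).2
      refine Or.inr ⟨(Finset.mem_filter.1 h1).2, ?_⟩
      rcases hz1 b a with h2 | h2 | h2
      · exact Or.inr h2
      · exact absurd h2 h
      · exact Or.inl h2
  -- For each pair at most one of the four corrections is nonzero: it turns weight 1 into 2, or
  -- weight 2 into 1 or 3.
  set q : V → V → ℤ := fun u v => w u v + r u v + r v u + z u v + z v u with hq
  have hqsymm : ∀ u v, q u v = q v u := by
    intro u v
    simp only [hq, hw u v]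
    ring
  have hqK : ∀ u v, 1 ≤ q u v ∧ q u v ≤ K := by
    have hside : ∀ u v, (z u v = 0 ∧ r v u = 0 ∧ r u v = 0 ∧ z v u = 0) ∨
        (∃ i, κ v = .reserve i) ∨ (∃ i, κ u = .reserve i) := by
      intro u v
      by_contra! hcon
      obtain ⟨h0, hv, hu⟩ := hcon
      have h1 : r u v = 0 := by
        rcases hr' u v with h | ⟨-, ⟨-, h⟩ | ⟨i, -, h⟩⟩
        exacts [h, absurd h (hv _), absurd h (hv _)]
      have h2 : r v u = 0 := by
        rcases hr' v u with h | ⟨-, ⟨-, h⟩ | ⟨i, -, h⟩⟩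
        exacts [h, absurd h (hu _), absurd h (hu _)]
      have h3 : z u v = 0 := by
        rcases hz' u v with h | ⟨⟨i, h, -⟩, -⟩
        exacts [h, absurd h (hu _)]
      have h4 : z v u = 0 := by
        rcases hz' v u with h | ⟨⟨i, h, -⟩, -⟩
        exacts [h, absurd h (hv _)]
      exact h0 h3 h2 h1 h4
    have hmain : ∀ u v i, κ v = .reserve i → 1 ≤ q u v ∧ q u v ≤ K := by
      intro u v i hv
      have h1 : r v u = 0 := by
        rcases hr' v u with h | ⟨-, ⟨h, -⟩ | ⟨j, h, -⟩⟩
        · exact h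
        · rw [hv] at h; cases h
        · rw [hv] at h; cases h
      have h2 : z u v = 0 := by
        rcases hz' u v with h | ⟨⟨j, -, h⟩, -⟩
        · exact h
        · rw [hv] at h; cases h
      have hK' : (3 : ℤ) ≤ K := by exact_mod_cast hK
      simp only [hq, h1, h2]
      rcases hr' u v with h3 | ⟨h3, h4⟩
      · rcases hz' v u with h5 | ⟨⟨j, h5, h6⟩, h7⟩
        · have := hw1 u v
          rw [h3, h5]
          push_cast
          omega
        · rw [hv] at h5
          cases h5
          rw [h3, hwA' u v i h6 hv]
          push_cast
          rcases h7 with h7 | h7 <;> rw [h7] <;> omega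
      · have h8 : z v u = 0 := by
          rcases hz' v u with h5 | ⟨⟨j, h5, h6⟩, h7⟩
          · exact h5
          · rw [hv] at h5
            cases h5
            rcases h4 with ⟨h, -⟩ | ⟨j, h, h'⟩
            · rw [h6] at h; cases h
            · rw [hv] at h'
              cases h'
              rw [h6] at h
              simp at h
        have h9 : w u v = 1 := by
          rcases h4 with ⟨h, -⟩ | ⟨j, h, h'⟩
          · exact hwR u v i h hv
          · exact hwA u v j h h'
        rw [h3, h8, h9]
        push_cast
        exact ⟨trivial, by omega⟩
    intro u v
    rcases hside u v with ⟨h1, h2, h3, h4⟩ | ⟨i, hv⟩ | ⟨i, hu⟩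
    · have := hw1 u v
      simp only [hq, h1, h2, h3, h4]
      push_cast
      omega
    · exact hmain u v i hv
    · rw [hqsymm]
      exact hmain v u i hu
  set ω : Sym2 V → ℕ := Sym2.lift ⟨fun u v => (q u v).toNat, fun u v => congrArg Int.toNat (hqsymm u v)⟩ with hω
  have hωq : ∀ u v, (ω s(u, v) : ℤ) = q u v := by
    intro u v
    have := (hqK u v).1
    simp only [hω, Sym2.lift_mk]
    omega
  have hdeg : ∀ v, (G.weightedDegree ω v : ℤ) = σ v + ∑ u ∈ G.neighborFinset v, (r v u : ℤ) +
      ∑ u ∈ G.neighborFinset v, (r u v : ℤ) + ∑ u ∈ G.neighborFinset v, z v u +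
      ∑ u ∈ G.neighborFinset v, z u v := by
    intro v
    rw [weightedDegree, hσ]
    push_cast
    simp only [hωq, hq, ← Finset.sum_add_distrib]
    exact Finset.sum_congr rfl fun u _ => by ring
  have hrS : ∀ v, ∑ u ∈ G.neighborFinset v, (r v u : ℤ) = (S v).card := by
    intro v
    simp only [hr]
    push_cast
    rw [Finset.sum_ite_mem, Finset.inter_eq_right.2 (hSN v)]
    simp
  have hr0 : ∀ v, (∀ i, κ v ≠ .reserve i) → ∑ u ∈ G.neighborFinset v, (r u v : ℤ) = 0 := by
    intro v hv
    refine Finset.sum_eq_zero fun u _ => ?_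
    rcases hr' u v with h | ⟨-, ⟨-, h⟩ | ⟨i, -, h⟩⟩
    exacts [by exact_mod_cast h, absurd h (hv _), absurd h (hv _)]
  have hz0 : ∀ v, (∀ i, κ v ≠ .reserve i) → ∑ u ∈ G.neighborFinset v, z v u = 0 := by
    intro v hv
    refine Finset.sum_eq_zero fun u _ => ?_
    rcases hz' v u with h | ⟨⟨i, h, -⟩, -⟩
    exacts [h, absurd h (hv _)]
  have hz0' : ∀ v, (∀ i, κ v ≠ .paired i) → ∑ u ∈ G.neighborFinset v, z u v = 0 := by
    intro v hv
    refine Finset.sum_eq_zero fun u _ => ?_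
    rcases hz' u v with h | ⟨⟨i, -, h⟩, -⟩
    exacts [h, absurd h (hv _)]
  have hdegR : ∀ v, κ v = .bulk → G.weightedDegree ω v = tR v := by
    intro v hv
    have := hdeg v
    rw [hrS, hr0 v (by simp [hv]), hz0 v (by simp [hv]), hz0' v (by simp [hv])] at this
    have := hSR v hv
    omega
  have hdegA : ∀ v i, κ v = .paired i →
      G.weightedDegree ω v = 2 * tA v ∨ G.weightedDegree ω v = 2 * tA v + 1 := by
    intro v i hv
    have h1 := hdeg v
    have h2 : ∑ u ∈ G.neighborFinset v, z u v = ∑ u ∈ B, z u v := by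
      have hsub : ∀ (T : Finset V), (∀ u, z u v ≠ 0 → u ∈ T) → ∑ u ∈ T, z u v = ∑ u, z u v := by
        intro T hT
        refine Finset.sum_subset (Finset.subset_univ _) fun u _ hu => ?_
        by_contra h
        exact hu (hT u h)
      rw [hsub B, hsub (G.neighborFinset v)]
      · intro u hu
        have := (Finset.mem_filter.1 (hz2 u v hu).2).1
        rw [mem_neighborFinset] at this ⊢
        exact this.symm
      · exact fun u hu => (hz2 u v hu).1
    rw [hrS, hr0 v (by simp [hv]), hz0 v (by simp [hv]), h2] at h1
    have h3 := hSA v i hv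
    rcases hz3 v with h | h <;> rw [h] at h1
    · left; omega
    · right; omega
  have hdegB : ∀ v i, κ v = .reserve i → G.weightedDegree ω v = y v := by
    intro v i hv
    have h1 := hdeg v
    have h2 := hy v (Finset.mem_filter.2 ⟨Finset.mem_univ _, i, hv⟩)
    have h3 : ∑ u ∈ G.neighborFinset v, z v u = ∑ u ∈ N v, z v u := by
      symm
      refine Finset.sum_subset (Finset.filter_subset _ _) fun u _ hu => ?_
      by_contra h
      exact hu (hz2 v u h).2
    have h4 : ∑ u ∈ G.neighborFinset v, (r v u : ℤ) = 0 := by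
      refine Finset.sum_eq_zero fun u _ => ?_
      rcases hr' v u with h | ⟨-, ⟨h, -⟩ | ⟨j, h, -⟩⟩
      · exact_mod_cast h
      · rw [hv] at h; cases h
      · rw [hv] at h; cases h
    rw [h4, h3, hz0' v (by simp [hv])] at h1
    simp only [hτ] at h2
    push_cast at h2
    omega
  have hmem : ∀ v, G.weightedDegree ω v ∈ F ∨ ∃ i, κ v = .reserve i := by
    intro v
    rcases hv : κ v with _ | i | i
    · left
      rw [hdegR v hv]
      exact Finset.mem_union_left _ (Finset.mem_image_of_mem _ (by simp [hR, hv]))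
    · left
      have hvA : v ∈ A := by simp [hA, hv]
      apply Finset.mem_union_right
      rcases hdegA v i hv with h | h
      · exact Finset.mem_union_left _ (Finset.mem_image.2 ⟨v, hvA, h.symm⟩)
      · exact Finset.mem_union_right _ (Finset.mem_image.2 ⟨v, hvA, h.symm⟩)
    · exact Or.inr ⟨i, rfl⟩
  refine ⟨ω, ?_, ?_⟩
  · intro e _
    induction e using Sym2.ind with
    | _ u v =>
      have h1 := hωq u v
      have h2 := hqK u v
      omega
  · have hBF : ∀ v i, κ v = .reserve i → G.weightedDegree ω v ∉ F := by
      intro v i hv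
      rw [hdegB v i hv]
      exact hyF v (Finset.mem_filter.2 ⟨Finset.mem_univ _, i, hv⟩)
    intro u v huv
    rcases hu : κ u with _ | i | i <;> rcases hv : κ v with _ | j | j
    · rw [hdegR u hu, hdegR v hv] at huv
      exact hRinj (by simp [hR, hu]) (by simp [hR, hv]) huv
    · have h1 := hdisj u (by simp [hR, hu]) v (by simp [hA, hv])
      rw [hdegR u hu] at huv
      rcases hdegA v j hv with h | h
      · exact absurd (huv.trans h) h1.1
      · exact absurd (huv.trans h) h1.2
    · exact absurd (huv ▸ (hmem u).resolve_right (by simp [hu])) (hBF v j hv)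
    · have h1 := hdisj v (by simp [hR, hv]) u (by simp [hA, hu])
      rw [hdegR v hv] at huv
      rcases hdegA u i hu with h | h
      · exact absurd (huv.symm.trans h) h1.1
      · exact absurd (huv.symm.trans h) h1.2
    · refine hAinj (by simp [hA, hu]) (by simp [hA, hv]) ?_
      have h1 := hdegA u i hu
      have h2 := hdegA v j hv
      omega
    · exact absurd (huv ▸ (hmem u).resolve_right (by simp [hu])) (hBF v j hv)
    · exact absurd (huv ▸ (hmem v).resolve_right (by simp [hv])) (hBF u i hu)
    · exact absurd (huv ▸ (hmem v).resolve_right (by simp [hv])) (hBF u i hu)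
    · rw [hdegB u i hu, hdegB v j hv] at huv
      exact hyinj (by simp [hB, hu]) (by simp [hB, hv]) huv

end SimpleGraph

/-! ### The random initial weighting and its means -/

namespace VertexKind

theorem sum_eq {M : Type*} [AddCommMonoid M] (f : VertexKind → M) :
    ∑ c, f c = f bulk + (f (paired false) + (f (paired true) + (f (reserve false) +
      f (reserve true)))) := by
  have h : (Finset.univ : Finset VertexKind) =
      {bulk, paired false, paired true, reserve false, reserve true} := by decide
  rw [h, Finset.sum_insert (by decide), Finset.sum_insert (by decide),
    Finset.sum_insert (by decide), Finset.sum_insert (by decide), Finset.sum_singleton]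

theorem card_eq : Fintype.card VertexKind = 5 := by decide

/-- The distribution of the kinds. -/
noncomputable def prob (α β : ℝ) : VertexKind → ℝ
  | bulk => 1 - α - β
  | paired _ => α / 2
  | reserve _ => β / 2

/-- The number of values that are kept for the final weighted degree of a vertex. -/
def size : VertexKind → ℝ
  | bulk => 1
  | paired _ => 2
  | reserve _ => 0

/-- The initial weight of an edge between two vertices with kinds `c`, `c'` and positions
`i, i' < n`. -/
def initialWeight (K n : ℕ) : VertexKind → ℕ → VertexKind → ℕ → ℕ
  | reserve _, _, reserve _, _ => 1
  | reserve _, _, bulk, _ => 1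
  | bulk, _, reserve _, _ => 1
  | reserve i, _, paired j, _ => if i = j then 1 else 2
  | paired i, _, reserve j, _ => if i = j then 1 else 2
  | bulk, i, bulk, i' => if n ≤ i + i' then K else 1
  | bulk, i, paired _, i' => if n ≤ i + i' then K else 1
  | paired _, i, bulk, i' => if n ≤ i + i' then K else 1
  | paired _, i, paired _, i' => if n ≤ i + i' then K else 1

theorem initialWeight_comm (K n : ℕ) (c c' : VertexKind) (i i' : ℕ) :
    initialWeight K n c i c' i' = initialWeight K n c' i' c i := by
  cases c <;> cases c' <;> simp [initialWeight, add_comm, eq_comm]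

theorem initialWeight_bounds {K : ℕ} (hK : 3 ≤ K) (n : ℕ) (c c' : VertexKind) (i i' : ℕ) :
    1 ≤ initialWeight K n c i c' i' ∧ initialWeight K n c i c' i' ≤ K := by
  cases c <;> cases c' <;> simp only [initialWeight] <;> (try split_ifs) <;> omega

/-- Exactly `i` positions `j < n` satisfy `n ≤ i + j`, each adding `K - 1` to the basic weight 1. -/
theorem sum_threshold (K n i : ℕ) (hi : i ≤ n) :
    ∑ j : Fin n, ((if n ≤ i + j then K else 1 : ℕ) : ℝ) = n + ((K : ℝ) - 1) * i := by
  have h1 : ∀ j : Fin n, ((if n ≤ i + j then K else 1 : ℕ) : ℝ) =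
      1 + ((K : ℝ) - 1) * (if n - i ≤ (j : ℕ) then 1 else 0) := by
    intro j
    by_cases h : n ≤ i + j
    · rw [if_pos h, if_pos (by omega)]; ring
    · rw [if_neg h, if_neg (by omega)]; simp
  rw [Finset.sum_congr rfl fun j _ => h1 j, Finset.sum_add_distrib, ← Finset.mul_sum,
    Fin.sum_univ_eq_sum_range (fun j => if n - i ≤ j then (1 : ℝ) else 0) n]
  have h2 : ∑ j ∈ Finset.range n, (if n - i ≤ j then (1 : ℝ) else 0) = i := by
    rw [← Finset.sum_filter]
    have : (Finset.range n).filter (fun j => n - i ≤ j) = Finset.Ico (n - i) n := by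
      ext j; simp; omega
    rw [this]
    simp [hi]
  rw [h2]
  simp

/-- The mean of the initial weight of an edge at a vertex with kind `c` and position `i`. -/
noncomputable def meanWeight (K n : ℕ) (α β : ℝ) (c : VertexKind) (i : ℕ) : ℝ :=
  ∑ l : VertexKind × Fin n, prob α β l.1 / n * (initialWeight K n c i l.1 l.2 : ℝ)

/-- Only the constant term depends on the kind: a paired vertex has weight 2 instead of 1 towards
half of the reserve. The means are thus progressions with a common gap, which bounds how many fall
into an interval. -/
theorem exists_meanWeight_eq (K : ℕ) {n : ℕ} (hn : 0 < n) (α β : ℝ) (c : VertexKind)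
    (hc : ∀ j, c ≠ reserve j) : ∃ m₀ : ℝ, ∀ i ≤ n,
      meanWeight K n α β c i = m₀ + (1 - β) * ((K : ℝ) - 1) / n * i := by
  have hn0 : (n : ℝ) ≠ 0 := by positivity
  rcases c with _ | b | b
  · refine ⟨1, fun i hi => ?_⟩
    simp only [meanWeight, Fintype.sum_prod_type, sum_eq, prob, initialWeight, ← Finset.mul_sum,
      sum_threshold K n i hi]
    simp
    field_simp
    ring
  · refine ⟨1 + β / 2, fun i hi => ?_⟩
    simp only [meanWeight, Fintype.sum_prod_type, sum_eq, prob, initialWeight, ← Finset.mul_sum,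
      sum_threshold K n i hi]
    cases b <;> simp <;> field_simp <;> ring
  · exact absurd rfl (hc b)

theorem sum_prob (α β : ℝ) {n : ℕ} (hn : 0 < n) :
    ∑ l : VertexKind × Fin n, prob α β l.1 / n = 1 := by
  have hn0 : (n : ℝ) ≠ 0 := by positivity
  simp only [Fintype.sum_prod_type, sum_eq, prob]
  simp
  field_simp
  ring

end VertexKind

theorem card_filter_arith_progression_le {n : ℕ} {lo hi m g : ℝ} (hg : 0 < g) (h : lo ≤ hi) :
    ((Finset.univ.filter fun i : Fin n => lo ≤ m + g * (i : ℕ) ∧ m + g * (i : ℕ) ≤ hi).card : ℝ) ≤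
      (hi - lo) / g + 1 := by
  set T := Finset.univ.filter fun i : Fin n => lo ≤ m + g * (i : ℕ) ∧ m + g * (i : ℕ) ≤ hi
  rcases T.eq_empty_or_nonempty with h0 | h0
  · rw [h0]
    have : 0 ≤ (hi - lo) / g := div_nonneg (by linarith) hg.le
    simp
    linarith
  · have h1 := (Finset.mem_filter.1 (T.min'_mem h0)).2.1
    have h2 := (Finset.mem_filter.1 (T.max'_mem h0)).2.2
    have hsub : T ⊆ Finset.Icc (T.min' h0) (T.max' h0) := fun i hi =>
      Finset.mem_Icc.2 ⟨T.min'_le i hi, T.le_max' i hi⟩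
    have hcard := Finset.card_le_card hsub
    rw [Fin.card_Icc] at hcard
    have hle : ((T.min' h0 : Fin n) : ℕ) ≤ (T.max' h0 : Fin n) := T.min'_le _ (T.max'_mem h0)
    have h3 : (T.card : ℝ) ≤ ((T.max' h0 : Fin n) : ℕ) + 1 - ((T.min' h0 : Fin n) : ℕ) := by
      have : T.card + ((T.min' h0 : Fin n) : ℕ) ≤ ((T.max' h0 : Fin n) : ℕ) + 1 := by omega
      have : ((T.card + ((T.min' h0 : Fin n) : ℕ) : ℕ) : ℝ) ≤ (((T.max' h0 : Fin n) : ℕ) + 1 : ℕ) :=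
        by exact_mod_cast this
      push_cast at this
      linarith
    have h4 : (((T.max' h0 : Fin n) : ℕ) : ℝ) - ((T.min' h0 : Fin n) : ℕ) ≤ (hi - lo) / g := by
      rw [le_div_iff₀ hg]
      linarith
    linarith

namespace VertexKind

/-- The mean load of an interval that is caused by one vertex of degree `d`. -/
theorem sum_prob_mul_size_le {K n : ℕ} (hK : 3 ≤ K) (hn : 0 < n) {α β d lo hi : ℝ} (hα : 0 ≤ α)
    (hβ : 0 ≤ β) (hαβ : α + β < 1) (hd : 0 < d) (h : lo ≤ hi) :
    ∑ l : VertexKind × Fin n, prob α β l.1 / n *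
      (if lo ≤ d * meanWeight K n α β l.1 l.2 ∧ d * meanWeight K n α β l.1 l.2 ≤ hi
        then l.1.size else 0) ≤
      (1 + α) * ((hi - lo) / (d * ((1 - β) * ((K : ℝ) - 1))) + 1 / n) := by
  have hn0 : (0 : ℝ) < n := by exact_mod_cast hn
  have hK0 : (0 : ℝ) < (K : ℝ) - 1 := by
    have : (3 : ℝ) ≤ K := by exact_mod_cast hK
    linarith
  set X := (hi - lo) / (d * ((1 - β) * ((K : ℝ) - 1))) + 1 / n with hX
  have hX0 : 0 ≤ X := by
    have : 0 ≤ hi - lo := by linarith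
    have : 0 < 1 - β := by linarith
    positivity
  have key : ∀ c : VertexKind, (∀ j, c ≠ reserve j) → 0 ≤ prob α β c → 0 ≤ c.size →
      ∑ i : Fin n, prob α β c / n *
      (if lo ≤ d * meanWeight K n α β c i ∧ d * meanWeight K n α β c i ≤ hi
        then c.size else 0) ≤ prob α β c * c.size * X := by
    intro c hc hp hs
    obtain ⟨m₀, hm⟩ := exists_meanWeight_eq K hn α β c hc
    set g := d * ((1 - β) * ((K : ℝ) - 1) / n) with hg
    have hg0 : 0 < g := by
      have : 0 < 1 - β := by linarith
      positivity
    have hcard := card_filter_arith_progression_le (n := n) (m := d * m₀) hg0 h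
    rw [← Finset.mul_sum, ← Finset.sum_filter, Finset.sum_const, nsmul_eq_mul]
    have hfilter : (Finset.univ.filter fun i : Fin n =>
        lo ≤ d * meanWeight K n α β c i ∧ d * meanWeight K n α β c i ≤ hi) =
        Finset.univ.filter fun i : Fin n =>
          lo ≤ d * m₀ + g * (i : ℕ) ∧ d * m₀ + g * (i : ℕ) ≤ hi := by
      apply Finset.filter_congr
      intro i _
      rw [hm i i.2.le, hg, mul_add, mul_assoc]
    rw [hfilter]
    calc prob α β c / n * (_ * c.size) ≤ prob α β c / n * (((hi - lo) / g + 1) * c.size) := by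
          gcongr
      _ = prob α β c * c.size * X := by
          have : 0 < 1 - β := by linarith
          rw [hX, hg]
          field_simp
  rw [Fintype.sum_prod_type, sum_eq]
  have h1 := key bulk (by simp) (by simp only [prob]; linarith) (by simp [size])
  have h2 := key (paired false) (by simp) (by simp only [prob]; linarith) (by simp [size])
  have h3 := key (paired true) (by simp) (by simp only [prob]; linarith) (by simp [size])
  simp only [prob, size] at h1 h2 h3 ⊢
  simp only [ite_self, mul_zero, Finset.sum_const_zero, add_zero]
  -- The mean size is `(1 - α - β) + 2 * α ≤ 1 + α`.
  nlinarith [mul_nonneg hβ hX0]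

end VertexKind

/-! ### Labellings with evenly spread weighted degrees -/

namespace SimpleGraph

open VertexKind in
/-- A labelling of the vertices by kinds and positions with typical statistics. -/
theorem exists_typical_labelling {V : Type*} [Fintype V] [DecidableEq V]
    (G : SimpleGraph V) [DecidableRel G.Adj] {K n : ℕ} (hK : 3 ≤ K) (hn : 0 < n)
    (hV : Fintype.card V = n) {α β s : ℝ} (hα : 0 ≤ α) (hβ : 0 ≤ β) (hαβ : α + β < 1) (hs : 0 < s)
    (hexp : 2 * (5 * (n : ℝ) ^ 2 + 5 * n + 5 + (K * n + 1) ^ 2) <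
      Real.exp (s ^ 2 / (2 * (K : ℝ) ^ 2 * n))) :
    ∃ x : V → VertexKind × Fin n,
      (∀ v (l : VertexKind × Fin n), |∑ u ∈ G.neighborFinset v,
        (initialWeight K n l.1 l.2 (x u).1 (x u).2 : ℝ) -
          G.degree v * meanWeight K n α β l.1 l.2| ≤ s) ∧
      (∀ v c, G.degree v * prob α β c - s ≤
        ((G.neighborFinset v).filter fun u => (x u).1 = c).card) ∧
      (∀ c, ((Finset.univ.filter fun u => (x u).1 = c).card : ℝ) ≤ n * prob α β c + s) ∧
      ∀ a b : ℕ, a ≤ K * n → b ≤ K * n →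
        ∑ v, (if a - s ≤ G.degree v * meanWeight K n α β (x v).1 (x v).2 ∧
          G.degree v * meanWeight K n α β (x v).1 (x v).2 ≤ b + s then (x v).1.size else 0) ≤
        (∑ v, ∑ l : VertexKind × Fin n, prob α β l.1 / n *
          (if a - s ≤ G.degree v * meanWeight K n α β l.1 l.2 ∧
            G.degree v * meanWeight K n α β l.1 l.2 ≤ b + s then l.1.size else 0)) + s := by
  have hK' : (3 : ℝ) ≤ K := by exact_mod_cast hK
  have hp : ∀ l : VertexKind × Fin n, 0 ≤ prob α β l.1 / n := by
    rintro ⟨c, i⟩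
    refine div_nonneg ?_ (by positivity)
    cases c <;> simp only [prob] <;> linarith
  -- Four families: weighted degrees, kinds among neighbours, kinds overall, interval loads. The
  -- first fixes every possible label `l` of `v` in advance, so it also covers the label that `v`
  -- itself receives.
  obtain ⟨x, hx⟩ := exists_forall_abs_sum_sub_le
    (I := (V × (VertexKind × Fin n)) ⊕ (V × VertexKind) ⊕ VertexKind ⊕
      (Fin (K * n + 1) × Fin (K * n + 1)))
    (M := K) (s := s) (V := V) hp (sum_prob α β hn)
    (f := Sum.elim
      (fun i u l => if u ∈ G.neighborFinset i.1 then
        (initialWeight K n i.2.1 i.2.2 l.1 l.2 : ℝ) else 0)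
      (Sum.elim (fun i u l => if u ∈ G.neighborFinset i.1 then if l.1 = i.2 then 1 else 0 else 0)
      (Sum.elim (fun c _ l => if l.1 = c then 1 else 0)
      (fun i v l => if ((i.1 : ℕ) : ℝ) - s ≤ G.degree v * meanWeight K n α β l.1 l.2 ∧
        G.degree v * meanWeight K n α β l.1 l.2 ≤ ((i.2 : ℕ) : ℝ) + s then l.1.size else 0))))
    (by linarith) (by omega) hs (by
      rintro (⟨v, l'⟩ | ⟨v, c⟩ | c | ⟨a, b⟩) u l
      · have h := initialWeight_bounds hK n l'.1 l.1 l'.2 l.2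
        have h2 : (initialWeight K n l'.1 l'.2 l.1 l.2 : ℝ) ≤ K := by exact_mod_cast h.2
        simp only [Sum.elim_inl]
        split_ifs
        · exact ⟨by positivity, h2⟩
        · exact ⟨le_rfl, by linarith⟩
      · simp only [Sum.elim_inr, Sum.elim_inl]
        split_ifs <;> constructor <;> linarith
      · simp only [Sum.elim_inr, Sum.elim_inl]
        split_ifs <;> constructor <;> linarith
      · simp only [Sum.elim_inr]
        have : 0 ≤ l.1.size ∧ l.1.size ≤ 2 := by
          rcases l with ⟨c, i⟩
          cases c <;> norm_num [size]
        split_ifs <;> constructor <;> linarith)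
    (by
      simp only [Fintype.card_sum, Fintype.card_prod, Fintype.card_fin, VertexKind.card_eq, hV]
      refine lt_of_eq_of_lt ?_ hexp
      push_cast
      ring)
  have hsplit : ∀ (v : V) (g : VertexKind × Fin n → ℝ),
      ∑ u, ∑ l : VertexKind × Fin n, prob α β l.1 / n *
        (if u ∈ G.neighborFinset v then g l else 0) =
      G.degree v * ∑ l : VertexKind × Fin n, prob α β l.1 / n * g l := by
    intro v g
    have : ∀ u, ∑ l : VertexKind × Fin n, prob α β l.1 / n *
        (if u ∈ G.neighborFinset v then g l else 0) =
        if u ∈ G.neighborFinset v then ∑ l : VertexKind × Fin n, prob α β l.1 / n * g l else 0 := by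
      intro u
      split_ifs <;> simp
    rw [Finset.sum_congr rfl fun u _ => this u, Finset.sum_ite_mem, Finset.univ_inter,
      Finset.sum_const, card_neighborFinset_eq_degree, nsmul_eq_mul]
  have hprob : ∀ c : VertexKind, ∑ l : VertexKind × Fin n, prob α β l.1 / n *
      (if l.1 = c then (1 : ℝ) else 0) = prob α β c := by
    intro c
    rw [Fintype.sum_prod_type, Finset.sum_eq_single c]
    · simp
      field_simp
    · intro b _ hb
      simp [hb]
    · simp
  refine ⟨x, fun v l => ?_, fun v c => ?_, fun c => ?_, fun a b ha hb => ?_⟩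
  · have h := hx (Sum.inl (v, l))
    simp only [Sum.elim_inl] at h
    rwa [hsplit v fun l' => (initialWeight K n l.1 l.2 l'.1 l'.2 : ℝ), Finset.sum_ite_mem,
      Finset.univ_inter] at h
  · have h := hx (Sum.inr (Sum.inl (v, c)))
    simp only [Sum.elim_inr, Sum.elim_inl] at h
    rw [hsplit v fun l' => if l'.1 = c then (1 : ℝ) else 0, Finset.sum_ite_mem,
      Finset.univ_inter, hprob, Finset.sum_boole] at h
    linarith [(abs_le.1 h).1]
  · have h := hx (Sum.inr (Sum.inr (Sum.inl c)))
    simp only [Sum.elim_inr, Sum.elim_inl] at h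
    rw [Finset.sum_congr rfl fun v _ => hprob c, Finset.sum_boole, Finset.sum_const,
      Finset.card_univ, hV, nsmul_eq_mul] at h
    linarith [(abs_le.1 h).2]
  · have h := hx (Sum.inr (Sum.inr (Sum.inr (⟨a, by omega⟩, ⟨b, by omega⟩))))
    simp only [Sum.elim_inr] at h
    linarith [(abs_le.1 h).2]

open VertexKind in
/-- A labelling such that the initial weighted degrees are spread out, with a gain in terms of the
surplus `ε` of the minimum degree. -/
theorem exists_labelling_of_low_load {V : Type*} [Fintype V] [DecidableEq V]
    (G : SimpleGraph V) [DecidableRel G.Adj] {K n : ℕ} (hK : 3 ≤ K) (hn : 0 < n)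
    (hV : Fintype.card V = n) {ε β s : ℝ} (hε : 0 < ε) (hε1 : ε ≤ 1) (hβ0 : 0 < β)
    (hβε : β ≤ ε / 10) (hdeg : ∀ v, (1 / ((K : ℝ) - 1) + ε) * n ≤ G.degree v) (hs : 1 ≤ s)
    (hexp : 2 * (5 * (n : ℝ) ^ 2 + 5 * n + 5 + (K * n + 1) ^ 2) <
      Real.exp (s ^ 2 / (2 * (K : ℝ) ^ 2 * n))) :
    ∃ (κ : V → VertexKind) (i : V → ℕ) (σ : V → ℕ),
      (∀ v, σ v = ∑ u ∈ G.neighborFinset v, initialWeight K n (κ u) (i u) (κ v) (i v)) ∧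
      (∀ v c, G.degree v * prob (ε / 10) β c - s ≤
        ((G.neighborFinset v).filter fun u => κ u = c).card) ∧
      (∀ c, ((Finset.univ.filter fun u => κ u = c).card : ℝ) ≤ n * prob (ε / 10) β c + s) ∧
      ∀ a b : ℕ, a ≤ b →
        ((((Finset.univ.filter fun v => κ v = .bulk).filter fun v => a ≤ σ v ∧ σ v ≤ b).card +
          2 * ((Finset.univ.filter fun v => ∃ i, κ v = .paired i).filter
            fun v => a ≤ σ v ∧ σ v ≤ b).card : ℕ) : ℝ) ≤
        (1 - ε / 2) * ((b : ℝ) - a) + 3 * s + 2 := by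
  have hK' : (3 : ℝ) ≤ K := by exact_mod_cast hK
  have hn0 : (0 : ℝ) < n := by exact_mod_cast hn
  set α : ℝ := ε / 10 with hα
  obtain ⟨x, hx1, hx2, hx3, hx4⟩ := G.exists_typical_labelling hK hn hV (α := α) (β := β) (s := s)
    (by positivity) hβ0.le (by linarith) (by linarith) hexp
  set κ : V → VertexKind := fun v => (x v).1 with hκ
  set w : V → V → ℕ := fun u v => initialWeight K n (x u).1 (x u).2 (x v).1 (x v).2 with hw
  set σ : V → ℕ := fun v => ∑ u ∈ G.neighborFinset v, w v u with hσ
  set load : ℕ → ℕ → ℕ := fun a b =>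
    ((Finset.univ.filter fun v => κ v = .bulk).filter fun v => a ≤ σ v ∧ σ v ≤ b).card +
      2 * ((Finset.univ.filter fun v => ∃ i, κ v = .paired i).filter
        fun v => a ≤ σ v ∧ σ v ≤ b).card with hload
  have hσμ : ∀ v, |(σ v : ℝ) - G.degree v * meanWeight K n α β (x v).1 (x v).2| ≤ s := by
    intro v
    have := hx1 v (x v)
    simp only [hσ, hw]
    push_cast
    exact this
  have hσK : ∀ v, σ v ≤ K * n := by
    intro v
    calc σ v ≤ ∑ u ∈ G.neighborFinset v, K :=
          Finset.sum_le_sum fun u _ => (initialWeight_bounds hK n _ _ _ _).2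
      _ = G.degree v * K := by simp
      _ ≤ n * K := Nat.mul_le_mul_right _ (hV ▸ (G.degree_lt_card_verts v).le)
      _ = K * n := mul_comm _ _
  -- The error `3 * s` consists of `2 * s` for widening the interval by `s` at both ends and `s` for
  -- the deviation of the load; the 2 collects the rounding terms `(1 + α) / n`.
  have hload_le : ∀ a b : ℕ, a ≤ b → b ≤ K * n →
      (load a b : ℝ) ≤ (1 - ε / 2) * ((b : ℝ) - a) + 3 * s + 2 := by
    intro a b hab hb
    have hab' : (a : ℝ) ≤ b := by exact_mod_cast hab
    have h1 : (load a b : ℝ) = ∑ v, if a ≤ σ v ∧ σ v ≤ b then (κ v).size else 0 := by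
      simp only [hload]
      push_cast
      rw [Finset.card_filter, Finset.card_filter]
      push_cast
      rw [Finset.sum_filter, Finset.sum_filter, Finset.mul_sum, ← Finset.sum_add_distrib]
      refine Finset.sum_congr rfl fun v _ => ?_
      rcases κ v with _ | i | i <;> simp [size]
    have h2 : (load a b : ℝ) ≤
        ∑ v, (if a - s ≤ G.degree v * meanWeight K n α β (x v).1 (x v).2 ∧
          G.degree v * meanWeight K n α β (x v).1 (x v).2 ≤ b + s then (x v).1.size else 0) := by
      rw [h1]
      refine Finset.sum_le_sum fun v _ => ?_
      have hsize : 0 ≤ (x v).1.size := by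
        rcases (x v).1 with _ | i | i <;> simp [size]
      have hdev := abs_le.1 (hσμ v)
      by_cases h : a ≤ σ v ∧ σ v ≤ b
      · have ha : (a : ℝ) ≤ σ v := by exact_mod_cast h.1
        have hb : (σ v : ℝ) ≤ b := by exact_mod_cast h.2
        rw [if_pos h, if_pos ⟨by linarith, by linarith⟩]
      · rw [if_neg h]
        split_ifs
        · exact hsize
        · exact le_rfl
    have h3 := hx4 a b (hab.trans hb) hb
    have h4 : ∀ v, (∑ l : VertexKind × Fin n, prob α β l.1 / n *
          (if a - s ≤ G.degree v * meanWeight K n α β l.1 l.2 ∧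
            G.degree v * meanWeight K n α β l.1 l.2 ≤ b + s then l.1.size else 0)) ≤
        ((1 - ε / 2) * ((b : ℝ) - a + 2 * s) + 2) / n := by
      intro v
      have hdv := hdeg v
      have hK1 : (0 : ℝ) < (K : ℝ) - 1 := by linarith
      have hd0 : (0 : ℝ) < G.degree v := lt_of_lt_of_le (by positivity) hdv
      refine (sum_prob_mul_size_le hK hn (by positivity) hβ0.le (by linarith) hd0
        (by linarith)).trans ?_
      have hden : (1 + 2 * ε) * n ≤ G.degree v * ((K : ℝ) - 1) := by
        calc (1 + 2 * ε) * n ≤ (1 + ((K : ℝ) - 1) * ε) * n := by gcongr; linarith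
          _ = (1 / ((K : ℝ) - 1) + ε) * n * ((K : ℝ) - 1) := by field_simp
          _ ≤ _ := by gcongr
      have hβ1 : 0 < 1 - β := by linarith
      have hlen : 0 ≤ (b : ℝ) + s - (a - s) := by linarith
      have h5 : ((b : ℝ) + s - (a - s)) / (G.degree v * ((1 - β) * ((K : ℝ) - 1))) ≤
          ((b : ℝ) + s - (a - s)) / ((1 - ε / 10) * ((1 + 2 * ε) * n)) := by
        have h6 : 0 < 1 - ε / 10 := by linarith
        apply div_le_div_of_nonneg_left hlen (by positivity)
        calc (1 - ε / 10) * ((1 + 2 * ε) * n) ≤ (1 - β) * (G.degree v * ((K : ℝ) - 1)) := by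
              gcongr
          _ = _ := by ring
      have h7 : (1 + α) * (((b : ℝ) + s - (a - s)) / ((1 - ε / 10) * ((1 + 2 * ε) * n))) ≤
          (1 - ε / 2) * ((b : ℝ) - a + 2 * s) / n := by
        have h6 : 0 < 1 - ε / 10 := by linarith
        rw [← mul_div_assoc, div_le_div_iff₀ (by positivity) hn0]
        -- The surplus factor `1 + 2 * ε` (from `K - 1 ≥ 2`) pays for the double size of paired
        -- vertices, for the range lost to the reserve, and for the gain `ε / 2`.
        have h8 : 1 + ε / 10 ≤ (1 - ε / 2) * ((1 - ε / 10) * (1 + 2 * ε)) := by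
          nlinarith [mul_nonneg hε.le (sub_nonneg.2 hε1), pow_pos hε 2, pow_pos hε 3]
        have h9 := mul_le_mul_of_nonneg_right h8 (mul_nonneg hlen hn0.le)
        calc (1 + α) * ((b : ℝ) + s - (a - s)) * n =
              (1 + ε / 10) * (((b : ℝ) + s - (a - s)) * n) := by rw [hα]; ring
          _ ≤ _ := h9
          _ = _ := by ring
      have h10 : (1 + α) * (1 / n) ≤ (2 : ℝ) / n := by
        rw [mul_one_div]
        gcongr
        linarith
      calc _ ≤ (1 + α) * (((b : ℝ) + s - (a - s)) / ((1 - ε / 10) * ((1 + 2 * ε) * n)) + 1 / n) := by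
            gcongr
        _ ≤ (1 - ε / 2) * ((b : ℝ) - a + 2 * s) / n + 2 / n := by
            rw [mul_add]
            exact add_le_add h7 h10
        _ = _ := by rw [add_div]
    have h5 := Finset.sum_le_sum fun v (_ : v ∈ Finset.univ) => h4 v
    rw [Finset.sum_const, Finset.card_univ, hV, nsmul_eq_mul, mul_div_cancel₀ _ hn0.ne'] at h5
    nlinarith [mul_pos hε (lt_of_lt_of_le one_pos hs)]
  -- The union bound covers endpoints up to `K * n` only, but no weighted degree exceeds `K * n`.
  have hload_le' : ∀ a b : ℕ, a ≤ b →
      (load a b : ℝ) ≤ (1 - ε / 2) * ((b : ℝ) - a) + 3 * s + 2 := by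
    intro a b hab
    have hab' : (a : ℝ) ≤ b := by exact_mod_cast hab
    have hε2 : 0 ≤ 1 - ε / 2 := by linarith
    rcases le_total b (K * n) with hb | hb
    · exact hload_le a b hab hb
    · rcases le_or_gt a (K * n) with ha | ha
      · have heq : load a b = load a (K * n) := by
          simp only [hload]
          congr 2
          · ext v; simp [hσK v, (hσK v).trans hb]
          · congr 1
            ext v; simp [hσK v, (hσK v).trans hb]
        rw [heq]
        refine (hload_le a _ ha le_rfl).trans ?_
        have : ((K * n : ℕ) : ℝ) ≤ b := by exact_mod_cast hb
        gcongr
      · have heq : load a b = 0 := by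
          have : ∀ v, ¬ (a ≤ σ v ∧ σ v ≤ b) := fun v h => by
            have := hσK v
            omega
          simp [hload, this]
        rw [heq]
        have := mul_nonneg hε2 (sub_nonneg.2 hab')
        push_cast
        linarith
  exact ⟨κ, fun v => (x v).2, σ,
    fun v => Finset.sum_congr rfl fun u _ => initialWeight_comm K n _ _ _ _, hx2, hx3, hload_le'⟩

/-! ### Choice of the parameters -/

open VertexKind in
/-- A dense graph with a minimum degree that is large in terms of the deviation `s` of the sums of
random labels has irregularity strength at most `K`. -/
theorem exists_injective_weighting_of_deviation {V : Type*} [Fintype V] [DecidableEq V]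
    (G : SimpleGraph V) [DecidableRel G.Adj] {K n : ℕ} (hK : 3 ≤ K)
    (hV : Fintype.card V = n) {ε s : ℝ} (hε : 0 < ε) (hε1 : ε ≤ 1)
    (hdeg : ∀ v, (1 / ((K : ℝ) - 1) + ε) * n ≤ G.degree v) (hs : 1 ≤ s)
    (hsn : 5000 * (K : ℝ) ^ 2 * s ≤ ε ^ 3 * n)
    (hexp : 2 * (5 * (n : ℝ) ^ 2 + 5 * n + 5 + (K * n + 1) ^ 2) <
      Real.exp (s ^ 2 / (2 * (K : ℝ) ^ 2 * n))) :
    ∃ ω : Sym2 V → ℕ, G.IsEdgeWeighting K ω ∧ Function.Injective (G.weightedDegree ω) := by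
  have hK' : (3 : ℝ) ≤ K := by exact_mod_cast hK
  have hn0 : (0 : ℝ) < n := by
    by_contra! h
    have : ε ^ 3 * n ≤ 0 := mul_nonpos_of_nonneg_of_nonpos (by positivity) h
    have : 0 < 5000 * (K : ℝ) ^ 2 * s := by positivity
    linarith
  have hn : 0 < n := by exact_mod_cast hn0
  -- Then `n * β` is half of the lower bound `ε ^ 2 * n / (80 * K)` for the slack `ε / 2 * M` at a
  -- reserve vertex with `M` toggling edges; the other half absorbs `D` and the multiples of `s`.
  obtain ⟨β, hβ⟩ : ∃ β : ℝ, β = ε ^ 2 / (160 * K) := ⟨_, rfl⟩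
  have hβ0 : 0 < β := hβ ▸ by positivity
  have hβε : β ≤ ε / 10 := by
    rw [hβ, div_le_div_iff₀ (by positivity) (by positivity)]
    nlinarith
  obtain ⟨κ, i, σ, hσ, hx2, hx3, hload⟩ := G.exists_labelling_of_low_load hK hn hV hε hε1 hβ0 hβε
    hdeg hs hexp
  obtain ⟨load, hloaddef⟩ : ∃ load : ℕ → ℕ → ℕ, ∀ a b, load a b =
      ((Finset.univ.filter fun v => κ v = .bulk).filter fun v => a ≤ σ v ∧ σ v ≤ b).card +
      2 * ((Finset.univ.filter fun v => ∃ i, κ v = .paired i).filter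
        fun v => a ≤ σ v ∧ σ v ≤ b).card := ⟨_, fun _ _ => rfl⟩
  have hload_le : ∀ a b : ℕ, a ≤ b →
      (load a b : ℝ) ≤ (1 - ε / 2) * ((b : ℝ) - a) + 3 * s + 2 := fun a b hab => by
    rw [hloaddef]
    exact hload a b hab
  -- the parameters
  obtain ⟨y, hy⟩ : ∃ y, y = s / ε := ⟨_, rfl⟩
  have hsy : s = y * ε := by rw [hy]; field_simp
  have hy0 : 0 < y := hy ▸ by positivity
  have hy1 : 1 ≤ y := by
    rw [hy, le_div_iff₀ hε]; linarith
  have hyn : 5000 * (K : ℝ) ^ 2 * y ≤ ε ^ 2 * n := by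
    rw [hsy] at hsn
    refine le_of_mul_le_mul_right ?_ hε
    linarith
  have hsley : s ≤ y := by rw [hsy]; nlinarith
  have hKsq : (K : ℝ) ≤ (K : ℝ) ^ 2 := le_self_pow₀ (by linarith) two_ne_zero
  -- With `12 * y = 12 * s / ε`, the gain `ε / 2 * D ≥ 6 * s` exceeds the load error `3 * s + 3`.
  obtain ⟨D, hD⟩ : ∃ D, D = ⌈12 * y⌉₊ := ⟨_, rfl⟩
  have hD1 : 12 * y ≤ D := hD ▸ Nat.le_ceil _
  have hD2 : (D : ℝ) < 12 * y + 1 := hD ▸ Nat.ceil_lt_add_one (by positivity)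
  have hdegK : ∀ v, (n : ℝ) / K ≤ G.degree v := by
    intro v
    refine le_trans ?_ (hdeg v)
    calc (n : ℝ) / K ≤ n / ((K : ℝ) - 1) := by gcongr <;> linarith
      _ = (1 / ((K : ℝ) - 1)) * n := by ring
      _ ≤ _ := by gcongr; linarith
  have hreserve : ∀ v i, (D : ℝ) ≤
      ((G.neighborFinset v).filter fun u => κ u = .reserve i).card := by
    intro v i
    refine le_trans ?_ (hx2 v (.reserve i))
    have h1 : (n : ℝ) / K * (β / 2) ≤ G.degree v * (β / 2) :=
      mul_le_mul_of_nonneg_right (hdegK v) (by positivity)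
    have h2 : 15 * y ≤ (n : ℝ) / K * (β / 2) := by
      have : (n : ℝ) / K * (β / 2) = ε ^ 2 * n / (320 * (K : ℝ) ^ 2) := by
        rw [hβ]; field_simp; ring
      rw [this, le_div_iff₀ (by positivity)]
      have : 0 < (K : ℝ) ^ 2 * y := by positivity
      linarith
    simp only [prob]
    linarith
  have hB : ((Finset.univ.filter fun v => ∃ i, κ v = .reserve i).card : ℝ) ≤ n * β + 2 * s := by
    have hsub : (Finset.univ.filter fun v => ∃ i, κ v = .reserve i) ⊆
        (Finset.univ.filter fun v => κ v = .reserve false) ∪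
          (Finset.univ.filter fun v => κ v = .reserve true) := by
      intro v hv
      obtain ⟨i, hi⟩ := (Finset.mem_filter.1 hv).2
      cases i <;> simp [hi]
    have h1 := (Finset.card_le_card hsub).trans (Finset.card_union_le _ _)
    have h2 : ((Finset.univ.filter fun v => ∃ i, κ v = .reserve i).card : ℝ) ≤
        (Finset.univ.filter fun v => κ v = .reserve false).card +
          (Finset.univ.filter fun v => κ v = .reserve true).card := by exact_mod_cast h1
    have h3 := hx3 (.reserve false)
    have h4 := hx3 (.reserve true)
    simp only [prob] at h3 h4
    linarith
  refine G.exists_injective_weighting_of_kinds hK κ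
    (fun u v => initialWeight K n (κ u) (i u) (κ v) (i v))
    (fun u v => initialWeight_comm K n _ _ _ _) (fun u v => initialWeight_bounds hK n _ _ _ _)
    ?_ ?_ ?_ hσ hloaddef (D := D) (fun v _ => by exact_mod_cast hreserve v false)
    (fun v i _ => by exact_mod_cast hreserve v i) ?_ ?_
  · intro u v j hu hv
    simp [hu, hv, initialWeight]
  · intro u v j hu hv
    simp [hu, hv, initialWeight]
  · intro u v j hu hv
    simp [hu, hv, initialWeight]
  · intro a b hab
    have h1 := hload_le (a - 1) b (by omega)
    have hab' : (a : ℝ) + D ≤ b := by exact_mod_cast hab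
    have ha1 : (a : ℝ) - 1 ≤ ((a - 1 : ℕ) : ℝ) := by
      have : a ≤ (a - 1) + 1 := by omega
      have : (a : ℝ) ≤ ((a - 1 : ℕ) : ℝ) + 1 := by exact_mod_cast this
      linarith
    have h2 : (load (a - 1) b : ℝ) + a ≤ b := by
      have h3 : (1 - ε / 2) * ((b : ℝ) - ((a - 1 : ℕ) : ℝ)) ≤ (1 - ε / 2) * ((b : ℝ) - a + 1) :=
        mul_le_mul_of_nonneg_left (by linarith) (by linarith)
      have h4 : ε / 2 * (12 * y) ≤ ε / 2 * ((b : ℝ) - a) :=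
        mul_le_mul_of_nonneg_left (by linarith) (by linarith)
      have h5 : ε / 2 * (12 * y) = 6 * s := by rw [hsy]; ring
      linarith
    exact_mod_cast h2
  · intro v j hv c
    set M := ((G.neighborFinset v).filter fun u => κ u = .paired (!j)).card with hM
    have hM1 : ε * n / (40 * K) ≤ M := by
      refine le_trans ?_ (hx2 v (.paired (!j)))
      have h1 : (n : ℝ) / K * (ε / 10 / 2) ≤ G.degree v * (ε / 10 / 2) :=
        mul_le_mul_of_nonneg_right (hdegK v) (by positivity)
      have h2 : (n : ℝ) / K * (ε / 10 / 2) = ε * n / (40 * K) + ε * n / (40 * K) := by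
        field_simp; ring
      have h3 : s ≤ ε * n / (40 * K) := by
        rw [le_div_iff₀ (by positivity)]
        have h4 : ε ^ 3 * n ≤ ε * n := by
          have : ε ^ 3 ≤ ε := by nlinarith [mul_pos hε hε]
          gcongr
        have h5 : s * (40 * K) ≤ 5000 * (K : ℝ) ^ 2 * s := by
          have h6 : 0 < (K : ℝ) * s := by positivity
          have h7 := mul_le_mul_of_nonneg_right hKsq (by linarith : 0 ≤ s)
          linarith
        linarith
      simp only [prob]
      linarith
    have h1 := hload_le (c - 1 - D) (c + M) (by omega)
    have hc : (c : ℝ) - 1 - D ≤ ((c - 1 - D : ℕ) : ℝ) := by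
      have : c ≤ (c - 1 - D) + 1 + D := by omega
      have : (c : ℝ) ≤ ((c - 1 - D : ℕ) : ℝ) + 1 + D := by exact_mod_cast this
      linarith
    have h2 : (load (c - 1 - D) (c + M) : ℝ) +
        (Finset.univ.filter fun v => ∃ i, κ v = .reserve i).card ≤ M := by
      have h3 : (1 - ε / 2) * (((c + M : ℕ) : ℝ) - ((c - 1 - D : ℕ) : ℝ)) ≤
          (1 - ε / 2) * ((M : ℝ) + 1 + D) :=
        mul_le_mul_of_nonneg_left (by push_cast; linarith) (by linarith)
      have h4 : (1 - ε / 2) * (1 + D : ℝ) ≤ 1 + D :=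
        mul_le_of_le_one_left (by positivity) (by linarith)
      have h5 : ε / 2 * (ε * n / (40 * K)) ≤ ε / 2 * M :=
        mul_le_mul_of_nonneg_left hM1 (by positivity)
      have h6 : ε / 2 * (ε * n / (40 * K)) = ε ^ 2 * n / (160 * K) + ε ^ 2 * n / (160 * K) := by
        field_simp; ring
      have h7 : n * β = ε ^ 2 * n / (160 * K) := by rw [hβ]; ring
      have h8 : 21 * y ≤ ε ^ 2 * n / (160 * K) := by
        rw [le_div_iff₀ (by positivity)]
        have h9 : 0 < (K : ℝ) * y := by positivity
        have h10 := mul_le_mul_of_nonneg_right hKsq hy0.le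
        linarith
      linarith
    exact_mod_cast h2

end SimpleGraph

/-! ### The upper bound in terms of the order -/

namespace SimpleGraph

/-- Take `s = 5 * K * √(n log n)`: the Hoeffding exponent becomes `25 / 2 * log n`, enough for a
family of polynomial size. The constant 32 works because `32 ^ 3 ≥ 5 * 5000`. -/
theorem irregularityStrength_le_of_minDegree {V : Type*} [Fintype V] (G : SimpleGraph V)
    [DecidableRel G.Adj] {K n : ℕ} (hK : 3 ≤ K) (hV : Fintype.card V = n) (hn : 2 ≤ n)
    (h : (G.minDegree : ℝ) ≥
      (1 / ((K : ℝ) - 1) + 32 * K / ((n : ℝ) / Real.log n) ^ ((1 : ℝ) / 6)) * n) :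
    G.irregularityStrength ≤ K := by
  classical
  have hK' : (3 : ℝ) ≤ K := by exact_mod_cast hK
  have hn' : (2 : ℝ) ≤ n := by exact_mod_cast hn
  have hlog2 : Real.log 2 ≤ Real.log n := Real.log_le_log (by norm_num) hn'
  have hlog : 0.69 < Real.log n := by linarith [Real.log_two_gt_d9]
  set L := Real.log n with hL
  set x : ℝ := ((n : ℝ) / L) ^ ((1 : ℝ) / 6) with hx
  have hx0 : 0 < x := by positivity
  have hx6 : x ^ 6 = n / L := by
    rw [hx, ← Real.rpow_natCast, ← Real.rpow_mul (by positivity)]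
    norm_num
  set ε : ℝ := 32 * K / x with hε
  have hε0 : 0 < ε := by positivity
  set q : ℝ := n / x ^ 3 with hq
  have hq0 : 0 < q := by positivity
  have hq2 : q ^ 2 = n * L := by
    have hL0 : L ≠ 0 := by linarith
    rw [hq, div_pow, ← pow_mul, hx6]
    field_simp
  have hq1 : 1 ≤ q := by
    have : 1 ≤ q ^ 2 := by rw [hq2]; nlinarith
    nlinarith
  have hεq : ε ^ 3 * n = 32768 * (K : ℝ) ^ 3 * q := by
    rw [hε, hq]
    field_simp
    ring
  have hne : Nonempty V := Fintype.card_pos_iff.1 (by omega)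
  have hlt : (G.minDegree : ℝ) < n := by
    exact_mod_cast hV ▸ G.minDegree_lt_card
  -- As degrees are below `n`, the hypothesis itself forces `ε ≤ 1`, and thereby `n ≥ 5000 * K`;
  -- smaller orders are vacuous.
  have hε1 : ε ≤ 1 := by
    have h1 : (1 / ((K : ℝ) - 1) + ε) * n < 1 * n := by linarith
    have h2 := lt_of_mul_lt_mul_right h1 (by positivity)
    have h3 : 0 < 1 / ((K : ℝ) - 1) := by
      apply one_div_pos.2; linarith
    linarith
  have hKq : 5000 * (K : ℝ) ^ 2 * (5 * K * q) ≤ ε ^ 3 * n := by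
    rw [hεq]
    have : 0 < (K : ℝ) ^ 3 * q := by positivity
    nlinarith
  have hnK : 5000 * (K : ℝ) ^ 2 * (5 * K * q) ≤ n := by
    have : ε ^ 3 ≤ 1 := pow_le_one₀ hε0.le hε1
    nlinarith
  have hKn : 5000 * K ≤ (n : ℝ) := by
    refine le_trans ?_ hnK
    have h1 : 1 ≤ (K : ℝ) * (5 * K * q) := by
      have : 1 ≤ (K : ℝ) * K := by nlinarith
      nlinarith
    nlinarith
  obtain ⟨ω, hω1, hω2⟩ := G.exists_injective_weighting_of_deviation hK hV hε0 hε1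
    (fun v => (ge_iff_le.1 h).trans (by exact_mod_cast G.minDegree_le_degree v))
    (s := 5 * K * q) (by nlinarith) hKq (by
      have h1 : (5 * K * q) ^ 2 / (2 * (K : ℝ) ^ 2 * n) = 25 / 2 * L := by
        rw [mul_pow, hq2]
        field_simp
        ring
      have h2 : (n : ℝ) ^ 12 ≤ Real.exp (25 / 2 * L) := by
        calc (n : ℝ) ^ 12 = Real.exp ((12 : ℕ) * L) := by
              rw [Real.exp_nat_mul, hL, Real.exp_log (by linarith)]
          _ ≤ _ := Real.exp_le_exp.2 (by push_cast; linarith)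
      rw [h1]
      refine lt_of_lt_of_le ?_ h2
      have h3 : (K : ℝ) * n + 1 ≤ 2 * (n : ℝ) ^ 2 := by nlinarith
      have h4 : ((K : ℝ) * n + 1) ^ 2 ≤ (2 * (n : ℝ) ^ 2) ^ 2 :=
        pow_le_pow_left₀ (by positivity) h3 2
      have h5 : (n : ℝ) ^ 2 ≤ (n : ℝ) ^ 4 := pow_le_pow_right₀ (by linarith) (by norm_num)
      have h6 : (n : ℝ) ≤ (n : ℝ) ^ 4 := le_self_pow₀ (by linarith) (by norm_num)
      have h7 : (n : ℝ) ^ 5 ≤ (n : ℝ) ^ 12 := pow_le_pow_right₀ (by linarith) (by norm_num)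
      have h8 : 15000 * (n : ℝ) ^ 4 ≤ (n : ℝ) ^ 5 := by
        rw [pow_succ (n : ℝ) 4, mul_comm]
        exact mul_le_mul_of_nonneg_left (by linarith) (by positivity)
      nlinarith)
  exact sInf_le ⟨K, by omega, rfl, ω, hω1, hω2⟩

/-! ### The lower bound by regular graphs -/

/-- Pigeonhole: weights up to `K` give only the `d * (K - 1) + 1` values in `[d, d * K]`. The order
is only bounded from below, so that every `n` can be served. -/
theorem lt_irregularityStrength_of_isRegularOfDegree {V : Type*} [Fintype V] (G : SimpleGraph V)
    [DecidableRel G.Adj] {K d : ℕ} (hK : 1 ≤ K) (hV : d * (K - 1) + 2 ≤ Fintype.card V)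
    (hd : G.IsRegularOfDegree d) : (K : ℕ∞) < G.irregularityStrength := by
  refine lt_of_lt_of_le (b := ((K + 1 : ℕ) : ℕ∞)) (by exact_mod_cast Nat.lt_succ_self K) ?_
  refine le_sInf ?_
  rintro _ ⟨k, -, rfl, ω, hω, hinj⟩
  norm_cast
  by_contra! hlt
  have hmem : ∀ v, G.weightedDegree ω v ∈ Finset.Icc d (d * K) := by
    intro v
    have hb : ∀ u ∈ G.neighborFinset v, 1 ≤ ω s(u, v) ∧ ω s(u, v) ≤ K := by
      intro u hu
      have := hω s(u, v) ((mem_neighborFinset _ _ _).1 hu).symm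
      omega
    have hcard : (G.neighborFinset v).card = d := hd v
    rw [Finset.mem_Icc]
    constructor
    · have := Finset.card_nsmul_le_sum _ (fun u => ω s(u, v)) 1 fun u hu => (hb u hu).1
      rw [hcard] at this
      simpa [weightedDegree] using this
    · have := Finset.sum_le_card_nsmul _ (fun u => ω s(u, v)) K fun u hu => (hb u hu).2
      rw [hcard] at this
      simpa [weightedDegree] using this
  have h1 := Finset.card_le_card_of_injOn (s := Finset.univ) _ (fun v _ => hmem v) hinj.injOn
  rw [Finset.card_univ, Nat.card_Icc] at h1
  obtain ⟨k', rfl⟩ : ∃ k', K = k' + 1 := ⟨K - 1, by omega⟩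
  rw [Nat.add_sub_cancel] at hV
  rw [mul_add, mul_one] at h1
  omega

/-- Regular graphs of any even degree below the order exist. -/
theorem exists_isRegularOfDegree_two_mul {n m : ℕ} (h : 2 * m < n) :
    ∃ (G : SimpleGraph (Fin n)) (_ : DecidableRel G.Adj), G.IsRegularOfDegree (2 * m) := by
  have : NeZero n := ⟨by omega⟩
  -- The connection set `{±1, …, ±m}` of a circulant graph.
  set T : Finset (Fin n) :=
    Finset.univ.filter fun x => (1 ≤ (x : ℕ) ∧ (x : ℕ) ≤ m) ∨ n - m ≤ (x : ℕ) with hT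
  have hcard : T.card = 2 * m := by
    have hmap : T.map Fin.valEmbedding = Finset.Icc 1 m ∪ Finset.Ico (n - m) n := by
      ext y
      simp only [hT, Finset.mem_map, Finset.mem_filter, Finset.mem_univ, true_and,
        Fin.valEmbedding_apply, Finset.mem_union, Finset.mem_Icc, Finset.mem_Ico]
      constructor
      · rintro ⟨x, hx, rfl⟩
        have := x.2
        omega
      · intro hy
        exact ⟨⟨y, by omega⟩, by simp only; omega, rfl⟩
    rw [← Finset.card_map Fin.valEmbedding, hmap, Finset.card_union_of_disjoint]
    · simp
      omega
    · rw [Finset.disjoint_left]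
      intro y h1 h2
      rw [Finset.mem_Icc] at h1
      rw [Finset.mem_Ico] at h2
      omega
  have hneg : ∀ x, x ∈ T → -x ∈ T := by
    intro x hx
    simp only [hT, Finset.mem_filter, Finset.mem_univ, true_and] at hx ⊢
    have hx0 : (x : ℕ) ≠ 0 := by omega
    have hv : ((-x : Fin n) : ℕ) = n - x := by
      rw [Fin.val_neg', Nat.mod_eq_of_lt (by omega)]
    have := x.2
    omega
  have h0 : (0 : Fin n) ∉ T := by
    simp only [hT, Finset.mem_filter, Finset.mem_univ, true_and]
    simp
    omega
  let G : SimpleGraph (Fin n) :=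
    { Adj := fun u v => v - u ∈ T
      symm := ⟨fun u v huv => by
        have := hneg _ huv
        rwa [neg_sub] at this⟩
      loopless := ⟨fun u hu => h0 (by simpa using hu)⟩ }
  have : DecidableRel G.Adj := fun u v => inferInstanceAs (Decidable (v - u ∈ T))
  refine ⟨G, inferInstance, fun v => ?_⟩
  rw [← card_neighborFinset_eq_degree, ← hcard]
  have : G.neighborFinset v = T.map (addLeftEmbedding v) := by
    ext u
    rw [mem_neighborFinset, Finset.mem_map]
    constructor
    · intro hu
      exact ⟨u - v, hu, by simp⟩
    · rintro ⟨y, hy, rfl⟩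
      change v + y - v ∈ T
      simpa using hy
  rw [this, Finset.card_map]

/-- Take the largest even degree `2 * m` with `2 * m * (K - 1) + 2 ≤ n`. The loss 3 is 2 for
rounding to an even degree plus `2 / (K - 1) ≤ 1`. -/
theorem exists_minDegree_and_lt_irregularityStrength {K n : ℕ} (hK : 3 ≤ K) (hn : 2 ≤ n) :
    ∃ (G : SimpleGraph (Fin n)) (_ : DecidableRel G.Adj),
      (1 / ((K : ℝ) - 1)) * n - 3 ≤ G.minDegree ∧ (K : ℕ∞) < G.irregularityStrength := by
  set m := (n - 2) / (2 * (K - 1)) with hm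
  have h1 : 2 * (K - 1) * m ≤ n - 2 := Nat.mul_div_le _ _
  have h2 : n - 2 < 2 * (K - 1) * (m + 1) := by
    have := Nat.lt_mul_div_succ (n - 2) (show 0 < 2 * (K - 1) by omega)
    simpa using this
  have h3 : 2 * m ≤ 2 * (K - 1) * m := by
    rw [mul_assoc]
    exact Nat.mul_le_mul_left 2 (Nat.le_mul_of_pos_left m (by omega))
  obtain ⟨G, hG, hreg⟩ := exists_isRegularOfDegree_two_mul (show 2 * m < n by omega)
  refine ⟨G, hG, ?_, G.lt_irregularityStrength_of_isRegularOfDegree (by omega) (d := 2 * m) ?_ hreg⟩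
  · have : Nonempty (Fin n) := ⟨⟨0, by omega⟩⟩
    have hmin : 2 * m ≤ G.minDegree := G.le_minDegree_of_forall_le_degree _ fun v => (hreg v).ge
    have hmin' : 2 * (m : ℝ) ≤ G.minDegree := by exact_mod_cast hmin
    have hK' : (3 : ℝ) ≤ K := by exact_mod_cast hK
    have h4 : (n : ℝ) < 2 * ((K : ℝ) - 1) * (m + 1) + 2 := by
      obtain ⟨k, rfl⟩ : ∃ k, K = k + 1 := ⟨K - 1, by omega⟩
      have : n < 2 * (k + 1 - 1) * (m + 1) + 2 := by omega
      rw [Nat.add_sub_cancel] at this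
      have : (n : ℝ) < 2 * k * (m + 1) + 2 := by exact_mod_cast this
      push_cast
      linarith
    have h5 : (1 / ((K : ℝ) - 1)) * n ≤ 2 * m + 3 := by
      rw [one_div_mul_eq_div, div_le_iff₀ (by linarith)]
      nlinarith
    linarith
  · rw [Fintype.card_fin, show 2 * m * (K - 1) = 2 * (K - 1) * m by ring]
    omega

end SimpleGraph

/-! ### The asymptotic threshold -/

theorem tendsto_const_div_rpow_div_log (C : ℝ) :
    Tendsto (fun n : ℕ => C / ((n : ℝ) / Real.log n) ^ ((1 : ℝ) / 6)) atTop (𝓝 0) := by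
  have h1 : Tendsto (fun n : ℕ => Real.log n / (n : ℝ)) atTop (𝓝 0) :=
    Real.isLittleO_log_id_atTop.tendsto_div_nhds_zero.comp tendsto_natCast_atTop_atTop
  have h2 := (h1.rpow_const (p := (1 : ℝ) / 6) (Or.inr (by norm_num))).const_mul C
  rw [Real.zero_rpow (by norm_num), mul_zero] at h2
  refine h2.congr fun n => ?_
  rw [← inv_div, Real.inv_rpow (div_nonneg (Nat.cast_nonneg n) (Real.log_natCast_nonneg n))]
  exact (div_eq_mul_inv _ _).symm

theorem theorem1 (K : ℕ) (hK : 3 ≤ K) :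
    -- the upper bound, with a constant depending on `K` only
    (∃ C : ℝ, ∀ (V : Type u) [Fintype V] (G : SimpleGraph V) [DecidableRel G.Adj] (n : ℕ),
      Fintype.card V = n → 2 ≤ n →
      (G.minDegree : ℝ) ≥
        (1 / ((K : ℝ) - 1) + C / ((n : ℝ) / Real.log n) ^ ((1 : ℝ) / 6)) * n →
      G.irregularityStrength ≤ K) ∧
    -- regular graphs of degree `d` and order `d (K - 1) + 2` have irregularity strength above `K`
    (∀ (V : Type u) [Fintype V] (G : SimpleGraph V) [DecidableRel G.Adj] (d : ℕ),
      Fintype.card V = d * (K - 1) + 2 → G.IsRegularOfDegree d →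
      (K : ℕ∞) < G.irregularityStrength) ∧
    -- such regular graphs exist for arbitrarily large `d`
    (∀ N : ℕ, ∃ d : ℕ, N ≤ d ∧
      ∃ (G : SimpleGraph (Fin (d * (K - 1) + 2))) (_ : DecidableRel G.Adj),
        G.IsRegularOfDegree d) ∧
    -- the optimal minimum degree threshold is asymptotic to `n / (K - 1)`
    Tendsto (fun n : ℕ => (SimpleGraph.irregularityThreshold K n : ℝ) / n) atTop
      (𝓝 (1 / ((K : ℝ) - 1))) ∧
    -- the optimal proportion `α` in the condition `δ ≥ (1 - α) n` satisfies `1 - α = 1 / (K - 1)`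
    IsLUB {α : ℝ | 0 < α ∧ α < 1 ∧ ∃ n₀ : ℕ, ∀ n : ℕ, n₀ ≤ n →
        ∀ (G : SimpleGraph (Fin n)) [DecidableRel G.Adj],
          (G.minDegree : ℝ) ≥ (1 - α) * n → G.irregularityStrength ≤ K}
      (1 - 1 / ((K : ℝ) - 1)) := by
  have hK' : (3 : ℝ) ≤ K := by exact_mod_cast hK
  have hinv : 0 < 1 / ((K : ℝ) - 1) := one_div_pos.2 (by linarith)
  have hinv2 : 1 / ((K : ℝ) - 1) ≤ 1 / 2 := one_div_le_one_div_of_le (by norm_num) (by linarith)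
  have hf := tendsto_const_div_rpow_div_log (32 * K)
  set f : ℕ → ℝ := fun n => 32 * K / ((n : ℝ) / Real.log n) ^ ((1 : ℝ) / 6) with hfdef
  have hupper : ∀ n : ℕ, 2 ≤ n → ∀ (G : SimpleGraph (Fin n)) [DecidableRel G.Adj],
      (1 / ((K : ℝ) - 1) + f n) * n ≤ G.minDegree → G.irregularityStrength ≤ K :=
    fun n hn G _ h => G.irregularityStrength_le_of_minDegree hK (Fintype.card_fin n) hn h
  refine ⟨⟨32 * K, fun V _ G _ n hV hn h => G.irregularityStrength_le_of_minDegree hK hV hn h⟩,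
    fun V _ G _ d hV hd => G.lt_irregularityStrength_of_isRegularOfDegree (by omega) hV.ge hd,
    fun N => ⟨2 * N, by omega, SimpleGraph.exists_isRegularOfDegree_two_mul ?_⟩, ?_, ?_, ?_⟩
  · have : 2 * N ≤ 2 * N * (K - 1) := Nat.le_mul_of_pos_right _ (by omega)
    omega
  · have hmem : ∀ n : ℕ, 2 ≤ n → ⌈(1 / ((K : ℝ) - 1) + f n) * n⌉₊ ∈
        {m : ℕ | ∀ (G : SimpleGraph (Fin n)) [DecidableRel G.Adj],
          m ≤ G.minDegree → G.irregularityStrength ≤ K} := by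
      intro n hn G _ hG
      exact hupper n hn G ((Nat.le_ceil _).trans (by exact_mod_cast hG))
    have hinvn : Tendsto (fun n : ℕ => (1 : ℝ) / n) atTop (𝓝 0) :=
      tendsto_one_div_atTop_nhds_zero_nat
    refine tendsto_of_tendsto_of_tendsto_of_le_of_le'
      (g := fun n : ℕ => 1 / ((K : ℝ) - 1) - 3 * (1 / (n : ℝ)))
      (h := fun n : ℕ => 1 / ((K : ℝ) - 1) + f n + 1 / (n : ℝ)) ?_ ?_ ?_ ?_
    · simpa using (tendsto_const_nhds (x := 1 / ((K : ℝ) - 1))).sub (hinvn.const_mul 3)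
    · simpa using ((tendsto_const_nhds (x := 1 / ((K : ℝ) - 1))).add hf).add hinvn
    · filter_upwards [eventually_ge_atTop 2] with n hn
      have hn0 : (0 : ℝ) < n := by exact_mod_cast (by omega : 0 < n)
      obtain ⟨G, _, hG1, hG2⟩ :=
        SimpleGraph.exists_minDegree_and_lt_irregularityStrength (n := n) hK hn
      -- `hmem` shows that the defining set is nonempty, so its infimum belongs to it and is not the
      -- default value 0.
      have hlt : G.minDegree < SimpleGraph.irregularityThreshold K n := by
        by_contra! hle
        exact absurd (Nat.sInf_mem ⟨_, hmem n hn⟩ G hle) (not_le.2 hG2)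
      have hlt' : (G.minDegree : ℝ) < SimpleGraph.irregularityThreshold K n := by
        exact_mod_cast hlt
      rw [le_div_iff₀ hn0, sub_mul, mul_assoc, one_div_mul_cancel hn0.ne']
      linarith
    · filter_upwards [eventually_ge_atTop 2] with n hn
      have hn0 : (0 : ℝ) < n := by exact_mod_cast (by omega : 0 < n)
      have h1 : SimpleGraph.irregularityThreshold K n ≤ ⌈(1 / ((K : ℝ) - 1) + f n) * n⌉₊ :=
        Nat.sInf_le (hmem n hn)
      have hf0 : 0 ≤ f n := div_nonneg (by positivity)
        (Real.rpow_nonneg (div_nonneg hn0.le (Real.log_natCast_nonneg n)) _)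
      have h2 := Nat.ceil_lt_add_one (a := (1 / ((K : ℝ) - 1) + f n) * n) (by positivity)
      have h3 : (SimpleGraph.irregularityThreshold K n : ℝ) ≤
        ⌈(1 / ((K : ℝ) - 1) + f n) * n⌉₊ := by exact_mod_cast h1
      rw [div_le_iff₀ hn0, add_mul _ (1 / (n : ℝ)), one_div_mul_cancel hn0.ne']
      linarith
  · rintro α ⟨-, -, n₀, hα⟩
    by_contra! hlt
    have hgap : 0 < 1 / ((K : ℝ) - 1) - (1 - α) := by linarith
    obtain ⟨N, hN⟩ := exists_nat_gt (3 / (1 / ((K : ℝ) - 1) - (1 - α)))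
    set n := max (max n₀ N) 2 with hn
    obtain ⟨G, _, hG1, hG2⟩ := SimpleGraph.exists_minDegree_and_lt_irregularityStrength
      (n := n) hK (le_max_right _ _)
    refine absurd (hα n ((le_max_left _ _).trans (le_max_left _ _)) G ?_) (not_le.2 hG2)
    have hNn : (N : ℝ) ≤ n := by exact_mod_cast (le_max_right n₀ N).trans (le_max_left _ _)
    have h3 : 3 < n * (1 / ((K : ℝ) - 1) - (1 - α)) :=
      (div_lt_iff₀ hgap).1 (hN.trans_le hNn)
    linarith
  · intro b hb
    by_contra! hlt
    set t : ℝ := 1 - 1 / ((K : ℝ) - 1) with ht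
    -- The bound `b` may be negative; `1 / 4` keeps `α` positive and is below `t ≥ 1 / 2`.
    set α : ℝ := max ((b + t) / 2) (1 / 4) with hα
    have hαt : α < t := max_lt (by linarith) (by linarith)
    have hbα : b < α := lt_of_lt_of_le (by linarith) (le_max_left _ _)
    have hα0 : 0 < α := lt_of_lt_of_le (by norm_num) (le_max_right _ _)
    obtain ⟨n₀, hn₀⟩ := eventually_atTop.1 (hf.eventually_lt_const (sub_pos.2 hαt))
    refine absurd (hb ⟨hα0, by linarith, max n₀ 2, fun n hn G _ hG => ?_⟩) (not_le.2 hbα)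
    refine hupper n ((le_max_right _ _).trans hn) G (le_trans ?_ hG)
    have := hn₀ n ((le_max_left _ _).trans hn)
    exact mul_le_mul_of_nonneg_right (by linarith) (Nat.cast_nonneg n)
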